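/- Let $n \ge 0$ and $m \geq n+1$ be integers and let $X$ be an $m \times m$ positive semidefinite Hermitian complex matrix with $n$ simple non-zero eigenvalues $0 < x_1 < x_2 < \cdots < x_n$ and the eigenvalue $0$ of multiplicity $m-n \geq 1$. Let $U$ be a Haar distributed random unitary matrix of size $m \times m$, and let $Y$ be the $(m-1) \times (m-1)$ principal submatrix of $U X U^*$ obtained by removing the last row and the last column. Then with probability one, $Y$ has exactly $n$ non-zero eigenvalues, counted with multiplicity (so that $0$ is an eigenvalue of $Y$ of multiplicity $m-1-n$ if $m-1-n>0$, and is not an eigenvalue of $Y$ if $m-1=n$); these are simple, and, written in increasing order as $y_1 < y_2 < \cdots < y_n$, they satisfy $$0 < y_1 < x_1 < y_2 < x_2 < \cdots < x_{n-1} < y_n < x_n. \qquad (*)$$ The random vector $(y_1, \ldots, y_n)$ has the joint density, with respect to Lebesgue measure on $\mathbb{R}^n$, $$\frac{(m-1)!}{(m-n-1)!} \, \prod_{k=1}^n \frac{y_k^{m-n-1}}{x_k^{m-n}} \; \frac{\Delta_n(y)}{\Delta_n(x)}$$ on the subset of $y = (y_1, \ldots, y_n) \in \mathbb{R}^n$ defined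 by the inequalities $(*)$, and density zero outside that subset. Here $\Delta_n(x) = \prod_{1 \le j < k \le n} (x_k - x_j)$, and empty products are equal to $1$. -/

import Mathlib

open MeasureTheory
open scoped Matrix Nat ComplexOrder

/-- The real eigenvalues of a Hermitian matrix, listed with multiplicity. -/
noncomputable def hermEigenvalues {d : ℕ} {A : Matrix (Fin d) (Fin d) ℂ} (hA : A.IsHermitian) :
    Multiset ℝ :=
  Finset.univ.val.map hA.eigenvalues

/-- The top left `(m - 1) × (m - 1)` corner of an `m × m` matrix: the last row and the last
column are removed. -/
def corner {m : ℕ} (A : Matrix (Fin m) (Fin m) ℂ) : Matrix (Fin (m - 1)) (Fin (m - 1)) ℂ :=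
  A.submatrix (Fin.castLE (Nat.sub_le m 1)) (Fin.castLE (Nat.sub_le m 1))

/-- The corner of the conjugate `U X U*` of `X` by a unitary matrix `U`. -/
def conjCorner {m : ℕ} (X : Matrix (Fin m) (Fin m) ℂ) (U : Matrix.unitaryGroup (Fin m) ℂ) :
    Matrix (Fin (m - 1)) (Fin (m - 1)) ℂ :=
  corner ((U : Matrix (Fin m) (Fin m) ℂ) * X * (U : Matrix (Fin m) (Fin m) ℂ)ᴴ)

theorem conjCorner_isHermitian {m : ℕ} {X : Matrix (Fin m) (Fin m) ℂ} (hX : X.IsHermitian)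
    (U : Matrix.unitaryGroup (Fin m) ℂ) : (conjCorner X U).IsHermitian :=
  (Matrix.isHermitian_mul_mul_conjTranspose (U : Matrix (Fin m) (Fin m) ℂ) hX).submatrix _

/-- The Vandermonde product `∏_{i < j} (x_j - x_i)`. -/
def vandermondeProd {n : ℕ} (x : Fin n → ℝ) : ℝ :=
  ∏ i, ∏ j ∈ Finset.Ioi i, (x j - x i)

/-- The set of `y` with `0 < y_1 < x_1 < y_2 < x_2 < ⋯ < x_{n-1} < y_n < x_n`. -/
def interlacingSet {n : ℕ} (x : Fin n → ℝ) : Set (Fin n → ℝ) :=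
  {y | (∀ k, 0 < y k) ∧ (∀ k, y k < x k) ∧ ∀ i j : Fin n, (i : ℕ) + 1 = j → x i < y j}

/-- The function
`(m-1)! / (m-n-1)! * ∏_k (y_k ^ (m-n-1) / x_k ^ (m-n)) * Δ_n(y) / Δ_n(x)` of `y`. -/
noncomputable def cornerDensity (m : ℕ) {n : ℕ} (x y : Fin n → ℝ) : ℝ :=
  ((m - 1)! : ℝ) / ((m - n - 1)! : ℝ) * (∏ k, y k ^ (m - n - 1) / x k ^ (m - n)) *
    (vandermondeProd y / vandermondeProd x)

/-! Put `s = m - n - 1`, diagonalise `X = V D V*` and let `Q = U V`. The characteristic polynomial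
of the corner is a diagonal cofactor of the characteristic matrix of `Q D Q*`, hence `∑ i,
|Q_{last,i}|² ∏_{j ≠ i} (X - d_j)`. The zero eigenvalue contributes a factor `X ^ s`; what remains
is a monic polynomial `R` of degree `n`, depending only on the weights `p k = |Q_{last,k}|²` at the
nonzero eigenvalues, with `R / (X ∏ (X - x k)) = (1 - ∑ p k) / X + ∑ p k / (X - x k)`.

If all these weights are positive, `R` alternates in sign along `0, x_1, …, x_n`, which forces one
root in each gap. Conversely `y` determines `p` by taking residues, so `rootWeights x` is a
bijection from the interlacing set onto the open simplex (`rootWeights_image`). Its Jacobian has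
absolute value `Δ(y) / (Δ(x) ∏ x k)`, and `1 - ∑ p k = ∏ y k / x k` (`one_sub_sum_rootWeights`).

It remains to find the law of `p`. A row of a Haar unitary matrix is distributed like a normalised
complex Gaussian vector, whose squared moduli are independent exponential variables up to scale. So
`p` has a Dirichlet law, with density proportional to `(1 - ∑ p k) ^ s`
(`lintegral_haar_dirichlet`). Multiplying by the Jacobian gives the stated density. -/

/-! ### Characteristic polynomial of a corner -/

open Polynomial in
/-- The characteristic polynomial of a top left corner is a diagonal cofactor of the
characteristic matrix. -/
theorem charpoly_submatrix_castSucc {R : Type*} [CommRing R] {k : ℕ}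
    (A : Matrix (Fin (k + 1)) (Fin (k + 1)) R) :
    (A.submatrix Fin.castSucc Fin.castSucc).charpoly =
      A.charmatrix.adjugate (Fin.last k) (Fin.last k) := by
  rw [Matrix.adjugate_fin_succ_eq_det_submatrix, Matrix.charpoly]
  have h : (-1 : R[X]) ^ ((Fin.last k : ℕ) + (Fin.last k : ℕ)) = 1 := by
    rw [← two_mul, pow_mul]; simp
  rw [h, one_mul, Fin.succAbove_last]
  congr 1
  ext1 i j
  simp [Matrix.charmatrix_apply, Matrix.diagonal_apply]

open Polynomial in
/-- The adjugate of the characteristic matrix of a matrix which is similar to a diagonal one. -/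
theorem adjugate_charmatrix_conj_diagonal {R ι : Type*} [CommRing R] [Fintype ι] [DecidableEq ι]
    {Q Q' : Matrix ι ι R} (h : Q * Q' = 1) (d : ι → R) (a b : ι) :
    (Q * Matrix.diagonal d * Q').charmatrix.adjugate a b =
      ∑ i, C (Q a i * Q' i b) * ∏ j ∈ Finset.univ.erase i, (X - C (d j)) := by
  have hC : Q.map C * Q'.map C = (1 : Matrix ι ι R[X]) := by
    rw [← Matrix.map_mul, h]; simp
  have hC' : Q'.map C * Q.map C = (1 : Matrix ι ι R[X]) := mul_eq_one_comm.mp hC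
  have hdet : (Q.map C).det * (Q'.map C).det = (1 : R[X]) := by
    rw [← Matrix.det_mul, hC, Matrix.det_one]
  have h1 : (Q.map C).adjugate = (Q.map C).det • Q'.map C := by
    calc (Q.map C).adjugate = Q'.map C * Q.map C * (Q.map C).adjugate := by rw [hC', one_mul]
      _ = _ := by rw [mul_assoc, Matrix.mul_adjugate]; simp
  have h2 : (Q'.map C).adjugate = (Q'.map C).det • Q.map C := by
    calc (Q'.map C).adjugate = Q.map C * Q'.map C * (Q'.map C).adjugate := by rw [hC, one_mul]
      _ = _ := by rw [mul_assoc, Matrix.mul_adjugate]; simp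
  have h3 : (Q * Matrix.diagonal d * Q').charmatrix =
      Q.map C * Matrix.diagonal (fun i => X - C (d i)) * Q'.map C := by
    have : Matrix.diagonal (fun i => X - C (d i)) =
        (X : R[X]) • (1 : Matrix ι ι R[X]) - (Matrix.diagonal d).map C := by
      ext1 i j
      by_cases hij : i = j
      · simp [hij]
      · simp [hij]
    rw [this, mul_sub, sub_mul, Matrix.mul_smul, mul_one, Matrix.smul_mul, hC,
      ← Matrix.map_mul, ← Matrix.map_mul, Matrix.charmatrix, Matrix.scalar_apply,
      Matrix.smul_one_eq_diagonal]
    rfl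
  rw [h3, Matrix.adjugate_mul_distrib, Matrix.adjugate_mul_distrib, h1, h2,
    Matrix.adjugate_diagonal, Matrix.mul_smul, Matrix.mul_smul, Matrix.smul_mul, smul_smul, hdet,
    one_smul, ← mul_assoc, Matrix.mul_apply]
  refine Finset.sum_congr rfl fun i _ => ?_
  rw [Matrix.mul_diagonal]
  simp only [Matrix.map_apply, map_mul]
  ring

/-! ### The polynomial with prescribed partial fraction weights -/

open Polynomial in
/-- The monic polynomial whose partial fraction expansion relative to `X * ∏ (X - x k)` has the
weights `p k` at `x k` and the weight `1 - ∑ p k` at `0`. -/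
noncomputable def weightPoly {n : ℕ} (x p : Fin n → ℝ) : ℝ[X] :=
  ∏ j, (X - C (x j)) + ∑ k, C (p k * x k) * ∏ j ∈ Finset.univ.erase k, (X - C (x j))

-- Omitting one factor leaves at least `s` of the `s + 1` factors `X`. The weights `q` enter only
-- through their sum `1 - ∑ p k`, and `X = (X - C (x k)) + C (x k)` turns the terms of the `p k`
-- into those of `weightPoly`.
open Polynomial in
theorem sum_prod_erase_sumElim {n s : ℕ} (x p : Fin n → ℝ) (q : Fin (s + 1) → ℝ)
    (h : ∑ i, q i + ∑ k, p k = 1) :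
    ∑ i : Fin (s + 1) ⊕ Fin n, C (Sum.elim q p i) *
      ∏ j ∈ Finset.univ.erase i, (X - C (Sum.elim (fun _ => 0) x j)) =
      X ^ s * weightPoly x p := by
  have hl : ∀ i : Fin (s + 1), ∏ j ∈ Finset.univ.erase (Sum.inl i : Fin (s + 1) ⊕ Fin n),
      (X - C (Sum.elim (fun _ => 0) x j)) = (X : ℝ[X]) ^ s * ∏ j, (X - C (x j)) := by
    intro i
    have : Finset.univ.erase (Sum.inl i : Fin (s + 1) ⊕ Fin n) =
        (Finset.univ.erase i).disjSum Finset.univ := by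
      ext a; cases a <;> simp
    rw [this, Finset.prod_disjSum]
    simp [Finset.card_erase_of_mem]
  have hr : ∀ k : Fin n, ∏ j ∈ Finset.univ.erase (Sum.inr k : Fin (s + 1) ⊕ Fin n),
      (X - C (Sum.elim (fun _ => 0) x j)) =
      (X : ℝ[X]) ^ (s + 1) * ∏ j ∈ Finset.univ.erase k, (X - C (x j)) := by
    intro k
    have : Finset.univ.erase (Sum.inr k : Fin (s + 1) ⊕ Fin n) =
        Finset.univ.disjSum (Finset.univ.erase k) := by
      ext a; cases a <;> simp
    rw [this, Finset.prod_disjSum]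
    simp
  rw [Fintype.sum_sum_type]
  simp only [hl, hr, Sum.elim_inl, Sum.elim_inr]
  rw [← Finset.sum_mul, ← map_sum, eq_sub_of_add_eq h, weightPoly]
  have hk : ∀ k : Fin n, C (p k) * ((X : ℝ[X]) ^ (s + 1) *
      ∏ j ∈ Finset.univ.erase k, (X - C (x j))) = X ^ s * (C (p k) * ∏ j, (X - C (x j)) +
      C (p k * x k) * ∏ j ∈ Finset.univ.erase k, (X - C (x j))) := by
    intro k
    rw [← Finset.mul_prod_erase Finset.univ _ (Finset.mem_univ k), map_mul]
    ring
  simp only [hk]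
  rw [← Finset.mul_sum, Finset.sum_add_distrib, ← Finset.sum_mul, ← map_sum, map_sub, map_one]
  ring

open Polynomial in
theorem eval_weightPoly {n : ℕ} (x p : Fin n → ℝ) (k : Fin n) :
    (weightPoly x p).eval (x k) = p k * x k * ∏ j ∈ Finset.univ.erase k, (x k - x j) := by
  have h0 : ∏ j, (x k - x j) = 0 := Finset.prod_eq_zero (Finset.mem_univ k) (sub_self _)
  simp only [weightPoly, eval_add, eval_prod, eval_finsetSum, eval_mul, eval_sub, eval_X, eval_C,
    h0, zero_add]
  rw [Finset.sum_eq_single k]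
  · intro i _ hi
    rw [Finset.prod_eq_zero (i := k) (by simp [Ne.symm hi]) (sub_self _), mul_zero]
  · simp

open Polynomial in
theorem eval_zero_weightPoly {n : ℕ} (x p : Fin n → ℝ) :
    (weightPoly x p).eval 0 = (1 - ∑ k, p k) * ∏ j, (-x j) := by
  simp only [weightPoly, eval_add, eval_prod, eval_finsetSum, eval_mul, eval_sub, eval_X, eval_C,
    zero_sub]
  rw [sub_mul, one_mul, Finset.sum_mul, sub_eq_add_neg, ← Finset.sum_neg_distrib]
  congr 1
  refine Finset.sum_congr rfl fun k _ => ?_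
  rw [← Finset.mul_prod_erase Finset.univ _ (Finset.mem_univ k)]
  ring

open Polynomial in
theorem degree_weightPoly_sub_lt {n : ℕ} (x p : Fin n → ℝ) :
    (∑ k, C (p k * x k) * ∏ j ∈ Finset.univ.erase k, (X - C (x j)) : ℝ[X]).degree <
      (n : WithBot ℕ) := by
  refine (degree_sum_le _ _).trans_lt ((Finset.sup_lt_iff (WithBot.bot_lt_coe n)).mpr fun k _ => ?_)
  refine ((degree_mul_le _ _).trans (add_le_add_left degree_C_le _)).trans_lt ?_
  rw [zero_add, degree_prod_of_monic _ _ fun j _ => monic_X_sub_C _]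
  simp only [degree_X_sub_C, Finset.sum_const, nsmul_eq_mul, mul_one]
  rw [Finset.card_erase_of_mem (Finset.mem_univ k), Finset.card_fin]
  have := k.pos
  exact Nat.cast_lt.mpr (Nat.sub_lt this one_pos)

open Polynomial in
theorem degree_prod_X_sub_C_fin {n : ℕ} (x : Fin n → ℝ) :
    (∏ j, (X - C (x j)) : ℝ[X]).degree = n := by
  rw [degree_prod_of_monic _ _ fun j _ => monic_X_sub_C _]
  simp

open Polynomial in
theorem degree_weightPoly {n : ℕ} (x p : Fin n → ℝ) : (weightPoly x p).degree = n := by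
  rw [weightPoly, degree_add_eq_left_of_degree_lt, degree_prod_X_sub_C_fin]
  rw [degree_prod_X_sub_C_fin]
  exact degree_weightPoly_sub_lt x p

open Polynomial in
theorem monic_weightPoly {n : ℕ} (x p : Fin n → ℝ) : (weightPoly x p).Monic := by
  refine (monic_prod_of_monic _ _ fun j _ => monic_X_sub_C _).add_of_left ?_
  rw [degree_prod_X_sub_C_fin]
  exact degree_weightPoly_sub_lt x p

-- Both sides are monic of degree `n`, so their difference has degree below `n` and `n` nodes
-- suffice. The nodes `v = x` recover the weights from the roots; the nodes `v = y` certify a list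
-- of distinct roots.
open Polynomial in
theorem weightPoly_eq_prod_iff_eval {n : ℕ} {x : Fin n → ℝ} (p y v : Fin n → ℝ)
    (hv : Function.Injective v) :
    weightPoly x p = ∏ j, (X - C (y j)) ↔
      ∀ k, (weightPoly x p).eval (v k) = ∏ j, (v k - y j) := by
  constructor
  · intro h k
    simp [h, eval_prod]
  · intro h
    refine eq_of_degree_le_of_eval_index_eq (s := Finset.univ) (v := v) hv.injOn ?_ ?_ ?_ ?_
    · simp [degree_weightPoly]
    · rw [degree_weightPoly, degree_prod_X_sub_C_fin]
    · rw [(monic_weightPoly x p).leadingCoeff,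
        (monic_prod_of_monic _ _ fun j _ => monic_X_sub_C _).leadingCoeff]
    · intro k _
      simp [h k, eval_prod]

/-! ### Bijection between interlacing roots and the open simplex -/

/-- The weights `p` for which `weightPoly x p` has the roots `y`. -/
noncomputable def rootWeights {n : ℕ} (x y : Fin n → ℝ) (k : Fin n) : ℝ :=
  (∏ l, (x k - y l)) / (x k * ∏ j ∈ Finset.univ.erase k, (x k - x j))

/-- The open simplex. -/
def openSimplex (n : ℕ) : Set (Fin n → ℝ) := {p | (∀ k, 0 < p k) ∧ ∑ k, p k < 1}

theorem prod_erase_sub_ne_zero {n : ℕ} {x : Fin n → ℝ} (hx : Function.Injective x) (k : Fin n) :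
    ∏ j ∈ Finset.univ.erase k, (x k - x j) ≠ 0 :=
  Finset.prod_ne_zero_iff.mpr fun _ hj => sub_ne_zero.mpr fun h => (Finset.ne_of_mem_erase hj)
    (hx h).symm

open Polynomial in
theorem weightPoly_eq_prod_iff {n : ℕ} {x : Fin n → ℝ} (hx_pos : ∀ k, 0 < x k)
    (hx : Function.Injective x) (p y : Fin n → ℝ) :
    weightPoly x p = ∏ j, (X - C (y j)) ↔ rootWeights x y = p := by
  rw [weightPoly_eq_prod_iff_eval p y x hx, funext_iff]
  refine forall_congr' fun k => ?_
  rw [eval_weightPoly, rootWeights, div_eq_iff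
    (mul_ne_zero (hx_pos k).ne' (prod_erase_sub_ne_zero hx k)), eq_comm, mul_assoc]

theorem interlacingSet.strictMono {n : ℕ} {x y : Fin n → ℝ} (hx : StrictMono x)
    (hy : y ∈ interlacingSet x) : StrictMono y := by
  intro i j hij
  have hij' : (i : ℕ) < j := hij
  have h1 := hy.2.2 ⟨j - 1, by omega⟩ j (by simp; omega)
  have h2 : x i ≤ x ⟨j - 1, by omega⟩ := hx.monotone (by rw [Fin.le_def]; simp; omega)
  linarith [hy.2.1 i]

/-- The weights determine the polynomial, hence its set of roots, and a strictly increasing tuple is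
determined by its range. -/
theorem rootWeights_injOn {n : ℕ} {x : Fin n → ℝ} (hx_pos : ∀ k, 0 < x k) (hx : StrictMono x) :
    Set.InjOn (rootWeights x) (interlacingSet x) := by
  intro y hy z hz h
  have h1 := (weightPoly_eq_prod_iff hx_pos hx.injective _ y).mpr rfl
  have h2 := (weightPoly_eq_prod_iff hx_pos hx.injective _ z).mpr h.symm
  refine ((interlacingSet.strictMono hx hy).range_inj (interlacingSet.strictMono hx hz)).mp ?_
  ext t
  have h3 := congrArg (Polynomial.eval t) (h1.symm.trans h2)
  have h4 : ∀ w : Fin n → ℝ, t ∈ Set.range w ↔ ∏ j, (t - w j) = 0 := fun w => by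
    simp [Finset.prod_eq_zero_iff, sub_eq_zero, eq_comm (a := t)]
  simp only [Polynomial.eval_prod, Polynomial.eval_sub, Polynomial.eval_X, Polynomial.eval_C] at h3
  rw [h4, h4, h3]

/-- By interlacing, `x k - y j` and `x k - x j` have the same sign for `j ≠ k`, so every paired
quotient is positive. -/
theorem rootWeights_pos {n : ℕ} {x y : Fin n → ℝ} (hx_pos : ∀ k, 0 < x k) (hx : StrictMono x)
    (hy : y ∈ interlacingSet x) (k : Fin n) : 0 < rootWeights x y k := by
  rw [rootWeights, ← Finset.mul_prod_erase Finset.univ _ (Finset.mem_univ k), mul_div_mul_comm,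
    ← Finset.prod_div_distrib]
  refine mul_pos (div_pos (sub_pos.mpr (hy.2.1 k)) (hx_pos k)) (Finset.prod_pos fun j hj => ?_)
  have hm := interlacingSet.strictMono hx hy
  rcases lt_or_gt_of_ne (Finset.ne_of_mem_erase hj) with h | h
  · exact div_pos (by linarith [hm h, hy.2.1 k]) (sub_pos.mpr (hx h))
  · refine div_pos_of_neg_of_neg ?_ (sub_neg.mpr (hx h))
    have h' : (k : ℕ) < j := h
    have h1 := hy.2.2 k ⟨k + 1, by omega⟩ rfl
    have h2 : y ⟨k + 1, by omega⟩ ≤ y j := hm.monotone (by rw [Fin.le_def]; simp; omega)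
    linarith

/-- The left side is the weight at the pole `0`; it is found by evaluating the polynomial at `0`. -/
theorem one_sub_sum_rootWeights {n : ℕ} {x : Fin n → ℝ} (hx_pos : ∀ k, 0 < x k)
    (hx : Function.Injective x) (y : Fin n → ℝ) :
    1 - ∑ k, rootWeights x y k = ∏ k, (y k / x k) := by
  have h1 := (weightPoly_eq_prod_iff hx_pos hx _ y).mpr rfl
  have h2 := eval_zero_weightPoly x (rootWeights x y)
  rw [h1, Polynomial.eval_prod] at h2
  rw [Finset.prod_div_distrib, eq_div_iff (Finset.prod_ne_zero_iff.mpr fun k _ => (hx_pos k).ne')]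
  simp only [Polynomial.eval_sub, Polynomial.eval_X, Polynomial.eval_C, zero_sub,
    Finset.prod_neg] at h2
  have h3 : ((-1 : ℝ) ^ (Finset.univ : Finset (Fin n)).card) ≠ 0 := pow_ne_zero _ (by norm_num)
  apply mul_left_cancel₀ h3
  linarith

theorem rootWeights_mem_openSimplex {n : ℕ} {x y : Fin n → ℝ} (hx_pos : ∀ k, 0 < x k)
    (hx : StrictMono x) (hy : y ∈ interlacingSet x) : rootWeights x y ∈ openSimplex n := by
  refine ⟨rootWeights_pos hx_pos hx hy, ?_⟩
  have h := one_sub_sum_rootWeights hx_pos hx.injective y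
  have h2 : 0 < ∏ k, (y k / x k) := Finset.prod_pos fun k _ => div_pos (hy.1 k) (hx_pos k)
  linarith

theorem exists_mem_Ioo_eval_eq_zero (q : Polynomial ℝ) {a b : ℝ} (hab : a < b)
    (h : q.eval a * q.eval b < 0) : ∃ t ∈ Set.Ioo a b, q.eval t = 0 := by
  rcases mul_neg_iff.mp h with ⟨h1, h2⟩ | ⟨h1, h2⟩
  · obtain ⟨t, ht, h0⟩ := intermediate_value_Ioo' hab.le q.continuous.continuousOn ⟨h2, h1⟩
    exact ⟨t, ht, h0⟩
  · obtain ⟨t, ht, h0⟩ := intermediate_value_Ioo hab.le q.continuous.continuousOn ⟨h1, h2⟩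
    exact ⟨t, ht, h0⟩

theorem exists_root_weightPoly {n : ℕ} {x p : Fin n → ℝ} (hx_pos : ∀ k, 0 < x k)
    (hx : StrictMono x) (hp : p ∈ openSimplex n) (k : Fin n) :
    ∃ t, 0 < t ∧ t < x k ∧ (∀ i : Fin n, (i : ℕ) + 1 = k → x i < t) ∧
      (weightPoly x p).eval t = 0 := by
  by_cases hk : (k : ℕ) = 0
  · have h : (weightPoly x p).eval 0 * (weightPoly x p).eval (x k) < 0 := by
      rw [eval_zero_weightPoly, eval_weightPoly,
        ← Finset.mul_prod_erase Finset.univ _ (Finset.mem_univ k)]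
      have h1 : 0 < (∏ j ∈ Finset.univ.erase k, (-x j)) *
          ∏ j ∈ Finset.univ.erase k, (x k - x j) := by
        rw [← Finset.prod_mul_distrib]
        refine Finset.prod_pos fun j hj => mul_pos_of_neg_of_neg (neg_neg_of_pos (hx_pos j)) ?_
        refine sub_neg.mpr (hx ?_)
        have := Finset.ne_of_mem_erase hj
        rw [Fin.lt_def]
        have : (j : ℕ) ≠ k := fun h => this (Fin.ext h)
        omega
      have h2 : 0 < (1 - ∑ i, p i) * x k * (p k * x k) :=
        mul_pos (mul_pos (sub_pos.mpr hp.2) (hx_pos k)) (mul_pos (hp.1 k) (hx_pos k))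
      nlinarith [mul_pos h2 h1]
    obtain ⟨t, ht, h0⟩ := exists_mem_Ioo_eval_eq_zero _ (hx_pos k) h
    exact ⟨t, ht.1, ht.2, fun i hi => by omega, h0⟩
  · obtain ⟨i, hi⟩ : ∃ i : Fin n, (i : ℕ) + 1 = k := ⟨⟨k - 1, by omega⟩, by simp; omega⟩
    have hik : i < k := by rw [Fin.lt_def]; omega
    -- For adjacent nodes every factor with `j ≠ i, k` has the same sign at both; the sign change
    -- comes from `(x i - x k) * (x k - x i)`.
    have h : (weightPoly x p).eval (x i) * (weightPoly x p).eval (x k) < 0 := by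
      rw [eval_weightPoly, eval_weightPoly,
        ← Finset.mul_prod_erase (Finset.univ.erase i) _
          (Finset.mem_erase.mpr ⟨hik.ne', Finset.mem_univ k⟩),
        ← Finset.mul_prod_erase (Finset.univ.erase k) _
          (Finset.mem_erase.mpr ⟨hik.ne, Finset.mem_univ i⟩), Finset.erase_right_comm]
      have h1 : 0 < (∏ j ∈ (Finset.univ.erase k).erase i, (x i - x j)) *
          ∏ j ∈ (Finset.univ.erase k).erase i, (x k - x j) := by
        rw [← Finset.prod_mul_distrib]
        refine Finset.prod_pos fun j hj => ?_
        have hj1 : (j : ℕ) ≠ i := fun h => Finset.ne_of_mem_erase hj (Fin.ext h)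
        have hj2 : (j : ℕ) ≠ k := fun h =>
          Finset.ne_of_mem_erase (Finset.mem_of_mem_erase hj) (Fin.ext h)
        rcases lt_or_gt_of_ne hj1 with h | h
        · exact mul_pos (sub_pos.mpr (hx h)) (sub_pos.mpr (hx (lt_trans h hik)))
        · exact mul_pos_of_neg_of_neg (sub_neg.mpr (hx h))
            (sub_neg.mpr (hx (by rw [Fin.lt_def]; omega)))
      have h2 : 0 < p i * x i * (p k * x k) * (x k - x i) ^ 2 :=
        mul_pos (mul_pos (mul_pos (hp.1 i) (hx_pos i)) (mul_pos (hp.1 k) (hx_pos k)))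
          (pow_pos (sub_pos.mpr (hx hik)) 2)
      nlinarith [mul_pos h2 h1]
    obtain ⟨t, ht, h0⟩ := exists_mem_Ioo_eval_eq_zero _ (hx hik) h
    refine ⟨t, (hx_pos i).trans ht.1, ht.2, fun j hj => ?_, h0⟩
    have : j = i := Fin.ext (by omega)
    exact this ▸ ht.1

theorem rootWeights_surjOn {n : ℕ} {x : Fin n → ℝ} (hx_pos : ∀ k, 0 < x k) (hx : StrictMono x) :
    Set.SurjOn (rootWeights x) (interlacingSet x) (openSimplex n) := by
  intro p hp
  choose y h1 h2 h3 h4 using exists_root_weightPoly hx_pos hx hp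
  have hy : y ∈ interlacingSet x := ⟨h1, h2, fun i j hij => h3 j i hij⟩
  refine ⟨y, hy, (weightPoly_eq_prod_iff hx_pos hx.injective p y).mp ?_⟩
  refine (weightPoly_eq_prod_iff_eval p y y (interlacingSet.strictMono hx hy).injective).mpr ?_
  intro k
  rw [h4, Finset.prod_eq_zero (Finset.mem_univ k) (sub_self _)]

theorem rootWeights_image {n : ℕ} {x : Fin n → ℝ} (hx_pos : ∀ k, 0 < x k) (hx : StrictMono x) :
    rootWeights x '' interlacingSet x = openSimplex n :=
  (rootWeights_surjOn hx_pos hx).image_eq_of_mapsTo fun _ =>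
    rootWeights_mem_openSimplex hx_pos hx

/-! ### Jacobian and change of variables -/

/-- The Jacobian matrix of `rootWeights x` at `y`. -/
noncomputable def rootWeightsJacobian {n : ℕ} (x y : Fin n → ℝ) : Matrix (Fin n) (Fin n) ℝ :=
  Matrix.of fun k l =>
    (x k * ∏ j ∈ Finset.univ.erase k, (x k - x j))⁻¹ * -∏ j ∈ Finset.univ.erase l, (x k - y j)

theorem hasFDerivAt_rootWeights {n : ℕ} (x y : Fin n → ℝ) :
    HasFDerivAt (rootWeights x)
      (LinearMap.toContinuousLinearMap (Matrix.toLin' (rootWeightsJacobian x y))) y := by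
  rw [hasFDerivAt_pi']
  intro k
  have h : HasFDerivAt (fun z : Fin n → ℝ => ∏ l, (x k - z l))
      (∑ l, (∏ j ∈ Finset.univ.erase l, (x k - y j)) •
        (-(ContinuousLinearMap.proj l : (Fin n → ℝ) →L[ℝ] ℝ))) y :=
    HasFDerivAt.finsetProd fun l _ => (hasFDerivAt_apply l y).const_sub (x k)
  have h2 := h.mul_const (x k * ∏ j ∈ Finset.univ.erase k, (x k - x j))⁻¹
  refine HasFDerivAt.congr_fderiv h2 ?_
  ext v
  simp [rootWeightsJacobian, Matrix.mulVec, dotProduct, Finset.mul_sum, mul_assoc]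

open Polynomial in
/-- Evaluation of `∏_{j ≠ l} (X - y j)` at `v k`, as a product of a Vandermonde matrix and the
coefficient matrix. -/
theorem prod_erase_sub_eq_vandermonde_mul {n : ℕ} (v y : Fin n → ℝ) :
    (Matrix.of fun k l => ∏ j ∈ Finset.univ.erase l, (v k - y j)) =
      Matrix.vandermonde v * Matrix.of fun (i l : Fin n) =>
        (∏ j ∈ Finset.univ.erase l, (X - C (y j)) : ℝ[X]).coeff i := by
  ext k l
  rw [Matrix.mul_apply]
  have hdeg : (∏ j ∈ Finset.univ.erase l, (X - C (y j)) : ℝ[X]).natDegree < n := by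
    rw [natDegree_prod_of_monic _ _ fun j _ => monic_X_sub_C _]
    simp [Finset.card_erase_of_mem, l.pos]
  have h := eval_eq_sum_range' hdeg (v k)
  rw [eval_prod] at h
  simp only [eval_sub, eval_X, eval_C] at h
  rw [Matrix.of_apply, h, Finset.sum_range]
  simp [Matrix.vandermonde_apply, mul_comm]

/-- Each unordered pair of indices occurs twice, once in each order. -/
theorem abs_prod_erase_sub {n : ℕ} (x : Fin n → ℝ) :
    |∏ k, ∏ j ∈ Finset.univ.erase k, (x k - x j)| = vandermondeProd x ^ 2 := by
  have h1 : ∀ k : Fin n, ∏ j ∈ Finset.univ.erase k, |x k - x j| =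
      (∏ j ∈ Finset.Ioi k, |x j - x k|) * ∏ j ∈ Finset.Iio k, |x k - x j| := by
    intro k
    have : Finset.univ.erase k = Finset.Ioi k ∪ Finset.Iio k := by
      ext j; simp [lt_or_lt_iff_ne, eq_comm]
    rw [this, Finset.prod_union]
    · congr 1
      exact Finset.prod_congr rfl fun j _ => abs_sub_comm _ _
    · exact Finset.disjoint_left.mpr fun j hj hj' =>
        lt_asymm (Finset.mem_Ioi.mp hj) (Finset.mem_Iio.mp hj')
  have h2 : ∏ k : Fin n, ∏ j ∈ Finset.Iio k, |x k - x j| =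
      ∏ k : Fin n, ∏ j ∈ Finset.Ioi k, |x j - x k| :=
    Finset.prod_comm' (by simp)
  rw [Finset.abs_prod]
  simp only [Finset.abs_prod, h1]
  rw [Finset.prod_mul_distrib, h2, vandermondeProd, ← sq_abs]
  simp only [Finset.abs_prod]
  ring

theorem vandermondeProd_pos {n : ℕ} {x : Fin n → ℝ} (hx : StrictMono x) :
    0 < vandermondeProd x :=
  Finset.prod_pos fun _ _ => Finset.prod_pos fun _ hj => sub_pos.mpr (hx (Finset.mem_Ioi.mp hj))

-- The coefficient matrix in the Vandermonde factorisation does not depend on the evaluation points.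
-- Its determinant is read off at the points `y`, where the left side is diagonal, and then used at
-- the points `x`.
open Polynomial in
theorem abs_det_prod_erase_sub {n : ℕ} {x y : Fin n → ℝ} (hx : StrictMono x) (hy : StrictMono y) :
    |(Matrix.of fun k l => ∏ j ∈ Finset.univ.erase l, (x k - y j)).det| =
      vandermondeProd x * vandermondeProd y := by
  have hV : ∀ v : Fin n → ℝ, (Matrix.vandermonde v).det = vandermondeProd v := fun v => by
    rw [Matrix.det_vandermonde, vandermondeProd]
  have hdiag : (Matrix.of fun k l => ∏ j ∈ Finset.univ.erase l, (y k - y j)) =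
      Matrix.diagonal fun k => ∏ j ∈ Finset.univ.erase k, (y k - y j) := by
    ext k l
    by_cases h : k = l
    · simp [h]
    · rw [Matrix.diagonal_apply_ne _ h, Matrix.of_apply]
      exact Finset.prod_eq_zero (i := k) (by simp [h]) (sub_self _)
  have h1 := congrArg (fun M => |M.det|) (prod_erase_sub_eq_vandermonde_mul y y)
  simp only [hdiag, Matrix.det_diagonal, abs_prod_erase_sub, Matrix.det_mul, hV, abs_mul,
    abs_of_pos (vandermondeProd_pos hy)] at h1
  rw [prod_erase_sub_eq_vandermonde_mul, Matrix.det_mul, abs_mul, hV,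
    abs_of_pos (vandermondeProd_pos hx)]
  congr 1
  apply mul_left_cancel₀ (vandermondeProd_pos hy).ne'
  rw [← h1, sq]

theorem abs_det_rootWeightsJacobian {n : ℕ} {x y : Fin n → ℝ} (hx_pos : ∀ k, 0 < x k)
    (hx : StrictMono x) (hy : StrictMono y) :
    |(rootWeightsJacobian x y).det| =
      (∏ k, x k)⁻¹ * (vandermondeProd y / vandermondeProd x) := by
  have h : rootWeightsJacobian x y =
      Matrix.diagonal (fun k => (x k * ∏ j ∈ Finset.univ.erase k, (x k - x j))⁻¹) *
        -(Matrix.of fun k l => ∏ j ∈ Finset.univ.erase l, (x k - y j)) := by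
    ext k l
    simp [rootWeightsJacobian, Matrix.diagonal_mul]
  have hpos := vandermondeProd_pos hx
  rw [h, Matrix.det_mul, Matrix.det_diagonal, Matrix.det_neg, abs_mul, abs_mul, abs_pow, abs_neg,
    abs_one, one_pow, one_mul, abs_det_prod_erase_sub hx hy, Finset.prod_inv_distrib, abs_inv,
    Finset.prod_mul_distrib, abs_mul, abs_prod_erase_sub,
    abs_of_pos (Finset.prod_pos fun k _ => hx_pos k)]
  field_simp

/-- With `s = m - n - 1`, split `y k ^ s / x k ^ (s + 1)` into `(x k)⁻¹`, which belongs to the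
Jacobian, and `(y k / x k) ^ s`, which belongs to the Dirichlet density. -/
theorem cornerDensity_eq {m n : ℕ} (hmn : n + 1 ≤ m) {x y : Fin n → ℝ} (hx_pos : ∀ k, 0 < x k)
    (hx : StrictMono x) (hy : StrictMono y) :
    cornerDensity m x y = |(rootWeightsJacobian x y).det| *
      (((m - 1)! : ℝ) / ((m - n - 1)! : ℝ) * (1 - ∑ k, rootWeights x y k) ^ (m - n - 1)) := by
  rw [abs_det_rootWeightsJacobian hx_pos hx hy, one_sub_sum_rootWeights hx_pos hx.injective,
    cornerDensity, ← Finset.prod_pow, ← Finset.prod_inv_distrib]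
  have : ∏ k, y k ^ (m - n - 1) / x k ^ (m - n) =
      (∏ k, (x k)⁻¹) * ∏ k, (y k / x k) ^ (m - n - 1) := by
    rw [← Finset.prod_mul_distrib]
    refine Finset.prod_congr rfl fun k _ => ?_
    have hxk := (hx_pos k).ne'
    obtain ⟨s, hs⟩ : ∃ s, m - n = s + 1 := ⟨m - n - 1, by omega⟩
    rw [hs, Nat.add_sub_cancel, div_pow, pow_succ]
    field_simp
  rw [this]
  ring

theorem measurableSet_interlacingSet {n : ℕ} (x : Fin n → ℝ) :
    MeasurableSet (interlacingSet x) := by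
  have : interlacingSet x = (⋂ k, {y | 0 < y k}) ∩ ((⋂ k, {y | y k < x k}) ∩
      ⋂ i : Fin n, ⋂ j : Fin n, ⋂ _ : (i : ℕ) + 1 = j, {y | x i < y j}) := by
    ext y; simp [interlacingSet]
  rw [this]
  refine .inter (.iInter fun k => ?_) (.inter (.iInter fun k => ?_)
    (.iInter fun i => .iInter fun j => .iInter fun _ => ?_))
  · exact measurableSet_lt measurable_const (measurable_pi_apply k)
  · exact measurableSet_lt (measurable_pi_apply k) measurable_const
  · exact measurableSet_lt measurable_const (measurable_pi_apply j)

theorem measurableSet_openSimplex (n : ℕ) : MeasurableSet (openSimplex n) := by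
  have : openSimplex n = (⋂ k, {y | 0 < y k}) ∩ {y | ∑ k, y k < 1} := by
    ext y; simp [openSimplex]
  rw [this]
  refine .inter (.iInter fun k => ?_) ?_
  · exact measurableSet_lt measurable_const (measurable_pi_apply k)
  · exact measurableSet_lt (by fun_prop) measurable_const

/-- The density of the Dirichlet distribution with parameters `(m - n, 1, …, 1)`. -/
noncomputable def dirichletDensity (m : ℕ) {n : ℕ} (p : Fin n → ℝ) : ℝ :=
  ((m - 1)! : ℝ) / ((m - n - 1)! : ℝ) * (1 - ∑ k, p k) ^ (m - n - 1)

theorem continuous_rootWeights {n : ℕ} (x : Fin n → ℝ) : Continuous (rootWeights x) :=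
  continuous_iff_continuousAt.mpr fun y => (hasFDerivAt_rootWeights x y).continuousAt

theorem lintegral_interlacingSet_cornerDensity {m n : ℕ} (hmn : n + 1 ≤ m) {x : Fin n → ℝ}
    (hx_pos : ∀ k, 0 < x k) (hx : StrictMono x) (f : (Fin n → ℝ) → ENNReal) :
    ∫⁻ p in openSimplex n, ENNReal.ofReal (dirichletDensity m p) * f p =
      ∫⁻ y in interlacingSet x, ENNReal.ofReal (cornerDensity m x y) * f (rootWeights x y) := by
  rw [← rootWeights_image hx_pos hx, lintegral_image_eq_lintegral_abs_det_fderiv_mul volume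
    (measurableSet_interlacingSet x)
    (fun y _ => (hasFDerivAt_rootWeights x y).hasFDerivWithinAt) (rootWeights_injOn hx_pos hx)]
  refine setLIntegral_congr_fun (measurableSet_interlacingSet x) fun y hy => ?_
  rw [cornerDensity_eq hmn hx_pos hx (interlacingSet.strictMono hx hy),
    ENNReal.ofReal_mul (abs_nonneg _), mul_assoc]
  congr 2
  simp [ContinuousLinearMap.det]

/-! ### Gaussian vectors and the Dirichlet distribution -/

/-- The pushforward of Lebesgue measure under the square of the absolute value on `ℂ`. -/
theorem lintegral_comp_norm_sq (f : ℝ → ENNReal) (hf : Measurable f) :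
    ∫⁻ z : ℂ, f (‖z‖ ^ 2) = ENNReal.ofReal Real.pi * ∫⁻ t in Set.Ioi 0, f t := by
  have himg : (fun r : ℝ => r ^ 2) '' Set.Ioi 0 = Set.Ioi 0 := by
    ext t
    constructor
    · rintro ⟨r, hr, rfl⟩
      exact pow_pos (Set.mem_Ioi.mp hr) 2
    · intro ht
      exact ⟨√t, Real.sqrt_pos.mpr ht, Real.sq_sqrt (le_of_lt ht)⟩
  have hinj : Set.InjOn (fun r : ℝ => r ^ 2) (Set.Ioi 0) := fun a ha b hb h =>
    (pow_left_inj₀ (le_of_lt ha) (le_of_lt hb) two_ne_zero).mp h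
  have hsub := lintegral_image_eq_lintegral_abs_deriv_mul measurableSet_Ioi
    (fun r _ => (hasDerivAt_pow 2 r).hasDerivWithinAt) hinj f
  rw [himg] at hsub
  rw [hsub, ← Complex.lintegral_comp_polarCoord_symm, polarCoord_target, Measure.volume_eq_prod,
    ← Measure.prod_restrict, lintegral_prod _ (by
      simp only [Complex.norm_polarCoord_symm]; fun_prop)]
  simp only [Complex.norm_polarCoord_symm, lintegral_const, Measure.restrict_apply_univ,
    Real.volume_Ioo, sq_abs, smul_eq_mul]
  rw [← lintegral_const_mul _ (by fun_prop)]
  refine setLIntegral_congr_fun measurableSet_Ioi fun r hr => ?_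
  have hr : 0 < r := hr
  -- The angle contributes `2π` and polar coordinates `r`, while the substitution `t = r ^ 2`
  -- contributes `2r`; the constant left over is `π`.
  have h1 : |((2 : ℕ) : ℝ) * r ^ (2 - 1)| = 2 * r := by
    rw [abs_of_pos (by positivity)]; norm_num
  rw [h1, mul_right_comm, ← ENNReal.ofReal_mul hr.le, ← mul_assoc,
    ← ENNReal.ofReal_mul Real.pi_pos.le]
  congr 2
  ring

theorem map_norm_sq_volume : (volume : Measure ℂ).map (fun z => ‖z‖ ^ 2) =
    ENNReal.ofReal Real.pi • volume.restrict (Set.Ioi 0) := by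
  refine Measure.ext_of_lintegral _ fun f hf => ?_
  rw [lintegral_map hf (by fun_prop), lintegral_comp_norm_sq f hf, lintegral_smul_measure,
    smul_eq_mul]

theorem lintegral_comp_norm_sq_pi (n : ℕ) (f : (Fin n → ℝ) → ENNReal) (hf : Measurable f) :
    ∫⁻ z : Fin n → ℂ, f (fun k => ‖z k‖ ^ 2) =
      ENNReal.ofReal Real.pi ^ n * ∫⁻ a in {a : Fin n → ℝ | ∀ k, 0 < a k}, f a := by
  have hset : {a : Fin n → ℝ | ∀ k, 0 < a k} = Set.univ.pi fun _ => Set.Ioi 0 := by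
    ext; simp
  have h2 : (volume : Measure (Fin n → ℂ)).map (fun z k => ‖z k‖ ^ 2) =
      ENNReal.ofReal Real.pi ^ n • volume.restrict {a : Fin n → ℝ | ∀ k, 0 < a k} := by
    have hs : SigmaFinite ((volume : Measure ℂ).map (fun z => ‖z‖ ^ 2)) := by
      rw [map_norm_sq_volume, ENNReal.ofReal]
      exact SMul.sigmaFinite _
    rw [volume_pi, Measure.pi_map_pi (f := fun _ z => ‖z‖ ^ 2) (fun _ => by fun_prop)]
    refine Measure.pi_eq fun s hs => ?_
    rw [hset, volume_pi, Measure.restrict_pi_pi, Measure.smul_apply, Measure.pi_pi,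
      map_norm_sq_volume]
    simp [Finset.prod_mul_distrib]
  rw [← smul_eq_mul, ← lintegral_smul_measure, ← h2, lintegral_map hf (by fun_prop)]

theorem lintegral_Ioo_pow_div_factorial (s : ℕ) {v : ℝ} (hv : 0 ≤ v) :
    ∫⁻ t in Set.Ioo 0 v, ENNReal.ofReal (t ^ s / s !) =
      ENNReal.ofReal (v ^ (s + 1) / (s + 1)!) := by
  rw [← ofReal_integral_eq_lintegral_ofReal, integral_div, ← integral_Ioc_eq_integral_Ioo,
    ← intervalIntegral.integral_of_le hv, integral_pow]
  · congr 1
    rw [Nat.factorial_succ]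
    push_cast
    field_simp
    simp
  · exact (Continuous.integrableOn_Icc (by fun_prop)).mono_set Set.Ioo_subset_Icc_self
  · refine (ae_restrict_iff' measurableSet_Ioo).mpr (ae_of_all _ fun t ht => ?_)
    have : 0 < t := ht.1
    simp only [Pi.zero_apply]
    positivity

/-- The convolution of `1` and `t ^ s / s !` on the positive half-line. -/
theorem lintegral_Ioi_add (s : ℕ) (f : ℝ → ENNReal) (hf : Measurable f) :
    ∫⁻ u in Set.Ioi 0, ∫⁻ t in Set.Ioi 0, f (u + t) * ENNReal.ofReal (t ^ s / s !) =
      ∫⁻ v in Set.Ioi 0, f v * ENNReal.ofReal (v ^ (s + 1) / (s + 1)!) := by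
  -- The region of integration in the coordinates `(t, v)` with `v = u + t`.
  set T : Set (ℝ × ℝ) := {q | 0 < q.1 ∧ q.1 < q.2} with hT
  have hTm : MeasurableSet T :=
    (measurableSet_lt measurable_const measurable_fst).inter
      (measurableSet_lt measurable_fst measurable_snd)
  set K : ℝ × ℝ → ENNReal := T.indicator fun q => f q.2 * ENNReal.ofReal (q.1 ^ s / s !) with hK
  have hKm : Measurable K := by
    rw [hK]
    exact Measurable.indicator (by fun_prop) hTm
  rw [lintegral_lintegral_swap (by fun_prop)]
  have h1 : ∀ t ∈ Set.Ioi (0 : ℝ),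
      ∫⁻ u in Set.Ioi 0, f (u + t) * ENNReal.ofReal (t ^ s / s !) = ∫⁻ v, K (t, v) := by
    intro t ht
    rw [← lintegral_indicator measurableSet_Ioi,
      ← lintegral_sub_right_eq_self (fun u : ℝ => (Set.Ioi 0).indicator _ u) t]
    refine lintegral_congr fun v => ?_
    by_cases hv : t < v
    · rw [Set.indicator_of_mem (show v - t ∈ Set.Ioi 0 from sub_pos.mpr hv), hK,
        Set.indicator_of_mem (show (t, v) ∈ T from ⟨ht, hv⟩), sub_add_cancel]
    · rw [Set.indicator_of_notMem (fun h => hv (sub_pos.mp (Set.mem_Ioi.mp h))), hK,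
        Set.indicator_of_notMem (fun h => hv h.2)]
  have h2 : ∀ v ∈ Set.Ioi (0 : ℝ), ∫⁻ t, K (t, v) =
      f v * ENNReal.ofReal (v ^ (s + 1) / (s + 1)!) := by
    intro v hv
    rw [← lintegral_Ioo_pow_div_factorial s (le_of_lt hv), ← lintegral_const_mul _ (by fun_prop),
      ← lintegral_indicator measurableSet_Ioo]
    rfl
  rw [setLIntegral_congr_fun measurableSet_Ioi h1, ← setLIntegral_congr_fun measurableSet_Ioi h2,
    ← lintegral_indicator measurableSet_Ioi, ← lintegral_indicator measurableSet_Ioi]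
  have h3 : ∀ t, (Set.Ioi (0 : ℝ)).indicator (fun t => ∫⁻ v, K (t, v)) t = ∫⁻ v, K (t, v) := by
    intro t
    refine Set.indicator_apply_eq_self.mpr fun ht => ?_
    rw [← lintegral_zero]
    exact lintegral_congr fun v => Set.indicator_of_notMem (fun h => ht h.1) _
  have h4 : ∀ v, (Set.Ioi (0 : ℝ)).indicator (fun v => ∫⁻ t, K (t, v)) v = ∫⁻ t, K (t, v) := by
    intro v
    refine Set.indicator_apply_eq_self.mpr fun hv => ?_
    rw [← lintegral_zero]
    exact lintegral_congr fun t => Set.indicator_of_notMem (fun h => hv (h.1.trans h.2)) _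
  simp only [h3, h4]
  exact lintegral_lintegral_swap hKm.aemeasurable

/-- The distribution of the squared Euclidean norm under Lebesgue measure on `ℂ ^ (s + 1)`. -/
theorem lintegral_comp_sum_norm_sq (s : ℕ) (f : ℝ → ENNReal) (hf : Measurable f) :
    ∫⁻ z : Fin (s + 1) → ℂ, f (∑ i, ‖z i‖ ^ 2) =
      ENNReal.ofReal Real.pi ^ (s + 1) *
        ∫⁻ t in Set.Ioi 0, f t * ENNReal.ofReal (t ^ s / s !) := by
  induction s generalizing f with
  | zero =>
    have h := (volume_preserving_funUnique (Fin 1) ℂ).lintegral_comp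
      (f := fun w => f (‖w‖ ^ 2)) (by fun_prop)
    rw [lintegral_comp_norm_sq f hf] at h
    simp only [MeasurableEquiv.funUnique_apply, Fin.default_eq_zero] at h
    simp only [Nat.reduceAdd, Finset.univ_unique, Fin.default_eq_zero, Finset.sum_singleton,
      zero_add, pow_one, pow_zero, Nat.factorial_zero, Nat.cast_one, div_one, ENNReal.ofReal_one,
      mul_one]
    convert h
  | succ s ih =>
    -- One coordinate is split off. Its squared modulus has constant density `π` on the half-line,
    -- and convolution with it raises `s` by one.
    rw [← (volume_preserving_piFinSuccAbove (fun _ : Fin (s + 2) => ℂ) 0).symm.lintegral_comp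
      (by fun_prop), Measure.volume_eq_prod, lintegral_prod _ (by fun_prop)]
    have h1 : ∀ (w : ℂ) (z : Fin (s + 1) → ℂ),
        ∑ i, ‖(MeasurableEquiv.piFinSuccAbove (fun _ : Fin (s + 2) => ℂ) 0).symm (w, z) i‖ ^ 2 =
        ‖w‖ ^ 2 + ∑ i, ‖z i‖ ^ 2 := by
      intro w z
      rw [Fin.sum_univ_succ]
      simp [MeasurableEquiv.piFinSuccAbove]
    simp only [h1]
    have h2 : ∀ w : ℂ, ∫⁻ z : Fin (s + 1) → ℂ, f (‖w‖ ^ 2 + ∑ i, ‖z i‖ ^ 2) =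
        ENNReal.ofReal Real.pi ^ (s + 1) *
        ∫⁻ t in Set.Ioi 0, f (‖w‖ ^ 2 + t) * ENNReal.ofReal (t ^ s / s !) := fun w =>
      ih (fun t => f (‖w‖ ^ 2 + t)) (by fun_prop)
    have hm : Measurable fun u : ℝ =>
        ∫⁻ t in Set.Ioi 0, f (u + t) * ENNReal.ofReal (t ^ s / s !) :=
      Measurable.lintegral_prod_right' (f := fun q : ℝ × ℝ =>
        f (q.1 + q.2) * ENNReal.ofReal (q.2 ^ s / s !)) (by fun_prop)
    have hm2 : Measurable fun w : ℂ =>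
        ∫⁻ t in Set.Ioi 0, f (‖w‖ ^ 2 + t) * ENNReal.ofReal (t ^ s / s !) :=
      hm.comp (by fun_prop : Measurable fun w : ℂ => ‖w‖ ^ 2)
    simp only [h2]
    rw [lintegral_const_mul _ hm2, lintegral_comp_norm_sq _ hm,
      lintegral_Ioi_add s f hf, ← mul_assoc, ← pow_succ]

theorem lintegral_exp_neg_mul_pow (k : ℕ) :
    ∫⁻ t in Set.Ioi (0 : ℝ), ENNReal.ofReal (Real.exp (-t) * t ^ k) = (k ! : ENNReal) := by
  have hc := Real.GammaIntegral_convergent (s := k + 1) (by positivity)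
  have hg := Real.Gamma_eq_integral (s := k + 1) (by positivity)
  simp only [add_sub_cancel_right, Real.rpow_natCast] at hc hg
  rw [← ofReal_integral_eq_lintegral_ofReal hc, ← hg, Real.Gamma_nat_eq_factorial,
    ENNReal.ofReal_natCast]
  refine (ae_restrict_iff' measurableSet_Ioi).mpr (ae_of_all _ fun t ht => ?_)
  have : 0 < t := ht
  simp only [Pi.zero_apply]
  positivity

theorem lintegral_comp_smul_pi (n : ℕ) (f : (Fin n → ℝ) → ENNReal) {v : ℝ} (hv : 0 < v) :
    ∫⁻ a, f a = ENNReal.ofReal (v ^ n) * ∫⁻ a, f (v • a) := by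
  have h := Measure.map_addHaar_smul (volume : Measure (Fin n → ℝ)) hv.ne'
  have h2 : ∫⁻ a, f (v • a) = ENNReal.ofReal |(v ^ n)⁻¹| * ∫⁻ a, f a := by
    rw [← smul_eq_mul, ← lintegral_smul_measure]
    rw [Module.finrank_fin_fun] at h
    rw [← h]
    exact ((Homeomorph.smulOfNeZero v hv.ne').measurableEmbedding.lintegral_map f).symm
  rw [h2, ← mul_assoc, ← ENNReal.ofReal_mul (by positivity), abs_of_pos (by positivity),
    mul_inv_cancel₀ (by positivity)]
  simp

/-- Normalised independent exponential and gamma variables have a Dirichlet distribution. -/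
theorem lintegral_dirichlet (n s : ℕ) (f : (Fin n → ℝ) → ENNReal) (hf : Measurable f) :
    ∫⁻ a in {a : Fin n → ℝ | ∀ k, 0 < a k}, ∫⁻ t in Set.Ioi 0,
      (ENNReal.ofReal (Real.exp (-(t + ∑ k, a k))) * f ((t + ∑ k, a k)⁻¹ • a)) *
        ENNReal.ofReal (t ^ s / s !) =
      ∫⁻ p in openSimplex n, ENNReal.ofReal (dirichletDensity (n + s + 1) p) * f p := by
  set A : Set (Fin n → ℝ) := {a | ∀ k, 0 < a k} with hA
  have hAm : MeasurableSet A := by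
    have : A = ⋂ k, {a | 0 < a k} := by ext; simp [hA]
    rw [this]
    exact .iInter fun k => measurableSet_lt measurable_const (measurable_pi_apply k)
  -- Here the second coordinate is the total `v = t + ∑ k, a k`.
  set T : Set ((Fin n → ℝ) × ℝ) := {q | q.1 ∈ A ∧ ∑ k, q.1 k < q.2} with hT
  have hTm : MeasurableSet T := (measurable_fst hAm).inter
      (measurableSet_lt (by fun_prop) measurable_snd)
  set K : (Fin n → ℝ) × ℝ → ENNReal := T.indicator fun q =>
    (ENNReal.ofReal (Real.exp (-q.2)) * f (q.2⁻¹ • q.1)) *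
      ENNReal.ofReal ((q.2 - ∑ k, q.1 k) ^ s / s !) with hK
  have hKm : Measurable K := by
    rw [hK]
    exact Measurable.indicator (by fun_prop) hTm
  have h1 : ∀ a ∈ A, ∫⁻ t in Set.Ioi 0,
      (ENNReal.ofReal (Real.exp (-(t + ∑ k, a k))) * f ((t + ∑ k, a k)⁻¹ • a)) *
        ENNReal.ofReal (t ^ s / s !) = ∫⁻ v, K (a, v) := by
    intro a ha
    rw [← lintegral_indicator measurableSet_Ioi,
      ← lintegral_sub_right_eq_self (fun u : ℝ => (Set.Ioi 0).indicator _ u) (∑ k, a k)]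
    refine lintegral_congr fun v => ?_
    by_cases hv : ∑ k, a k < v
    · rw [Set.indicator_of_mem (show v - ∑ k, a k ∈ Set.Ioi 0 from sub_pos.mpr hv), hK,
        Set.indicator_of_mem (show (a, v) ∈ T from ⟨ha, hv⟩), sub_add_cancel]
    · rw [Set.indicator_of_notMem (fun h => hv (sub_pos.mp (Set.mem_Ioi.mp h))), hK,
        Set.indicator_of_notMem (fun h => hv h.2)]
  have h2 : ∀ a, A.indicator (fun a => ∫⁻ v, K (a, v)) a = ∫⁻ v, K (a, v) := by
    intro a
    refine Set.indicator_apply_eq_self.mpr fun ha => ?_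
    rw [← lintegral_zero]
    exact lintegral_congr fun v => Set.indicator_of_notMem (fun h => ha h.1) _
  have h3 : ∀ v, (Set.Ioi (0 : ℝ)).indicator (fun v => ∫⁻ a, K (a, v)) v = ∫⁻ a, K (a, v) := by
    intro v
    refine Set.indicator_apply_eq_self.mpr fun hv => ?_
    rw [← lintegral_zero]
    refine lintegral_congr fun a => Set.indicator_of_notMem (fun h => hv ?_) _
    exact lt_of_le_of_lt (Finset.sum_nonneg fun k _ => (h.1 k).le) h.2
  -- Substituting `a = v • p` separates the total from the proportions: `v ^ n` is the Jacobian and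
  -- `v ^ s` comes from the gamma weight. Integrating over `v` then yields `(n + s)!`, the numerator
  -- of the Dirichlet constant.
  have h4 : ∀ v ∈ Set.Ioi (0 : ℝ), ∫⁻ a, K (a, v) =
      ENNReal.ofReal (Real.exp (-v) * v ^ (n + s)) *
        ∫⁻ p in openSimplex n, f p * ENNReal.ofReal ((1 - ∑ k, p k) ^ s / s !) := by
    intro v hv
    have hv : 0 < v := hv
    rw [lintegral_comp_smul_pi n _ hv, ← lintegral_indicator (measurableSet_openSimplex n),
      pow_add, ← mul_assoc, mul_comm (Real.exp _), mul_assoc, ENNReal.ofReal_mul (by positivity),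
      mul_assoc]
    congr 1
    rw [← lintegral_const_mul _ (Measurable.indicator (by fun_prop) (measurableSet_openSimplex n))]
    refine lintegral_congr fun p => ?_
    have hiff : (v • p, v) ∈ T ↔ p ∈ openSimplex n := by
      simp only [hT, hA, openSimplex, Set.mem_ofPred_eq, Pi.smul_apply, smul_eq_mul,
        ← Finset.mul_sum]
      refine and_congr (forall_congr' fun k => mul_pos_iff_of_pos_left hv) ?_
      rw [← lt_div_iff₀' hv, div_self hv.ne']
    by_cases hp : p ∈ openSimplex n
    · rw [hK, Set.indicator_of_mem (hiff.mpr hp), Set.indicator_of_mem hp]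
      have hs : 0 < 1 - ∑ k, p k := sub_pos.mpr hp.2
      simp only [smul_smul, inv_mul_cancel₀ hv.ne', one_smul, Pi.smul_apply, smul_eq_mul,
        ← Finset.mul_sum]
      have : (v - v * ∑ k, p k) ^ s / s ! = v ^ s * ((1 - ∑ k, p k) ^ s / s !) := by
        rw [← mul_one_sub, mul_pow, mul_div_assoc]
      rw [this, ENNReal.ofReal_mul (by positivity), ENNReal.ofReal_mul (by positivity)]
      ring
    · rw [hK, Set.indicator_of_notMem (fun h => hp (hiff.mp h)), Set.indicator_of_notMem hp,
        mul_zero]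
  rw [setLIntegral_congr_fun hAm h1, ← lintegral_indicator hAm]
  simp only [h2]
  rw [lintegral_lintegral_swap (f := fun a v => K (a, v)) hKm.aemeasurable, ← lintegral_congr h3,
    lintegral_indicator measurableSet_Ioi, setLIntegral_congr_fun measurableSet_Ioi h4,
    lintegral_mul_const _ (by fun_prop), lintegral_exp_neg_mul_pow,
    ← lintegral_const_mul _ (by fun_prop)]
  refine setLIntegral_congr_fun (measurableSet_openSimplex n) fun p hp => ?_
  have hs : 0 < 1 - ∑ k, p k := sub_pos.mpr hp.2
  have h5 : n + s + 1 - 1 = n + s := rfl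
  have h6 : n + s + 1 - n - 1 = s := by omega
  rw [dirichletDensity, h5, h6, ← ENNReal.ofReal_natCast, mul_left_comm, mul_comm,
    ← ENNReal.ofReal_mul (by positivity)]
  congr 2
  ring

/-- The squared absolute values of the coordinates of `g` with indices `e.symm (inr k)`, divided
by the squared Euclidean norm of `g`. -/
noncomputable def sphereWeights {m n s : ℕ} (e : Fin m ≃ Fin (s + 1) ⊕ Fin n) (g : Fin m → ℂ)
    (k : Fin n) : ℝ :=
  (∑ i, ‖g i‖ ^ 2)⁻¹ * ‖g (e.symm (Sum.inr k))‖ ^ 2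

theorem measurable_sphereWeights {m n s : ℕ} (e : Fin m ≃ Fin (s + 1) ⊕ Fin n) :
    Measurable (sphereWeights e) := by
  unfold sphereWeights
  fun_prop

theorem sphereWeights_smul {m n s : ℕ} (e : Fin m ≃ Fin (s + 1) ⊕ Fin n) {c : ℝ} (hc : c ≠ 0)
    (g : Fin m → ℂ) : sphereWeights e ((c : ℂ) • g) = sphereWeights e g := by
  ext k
  simp only [sphereWeights, Pi.smul_apply, smul_eq_mul, norm_mul, mul_pow, ← Finset.mul_sum,
    Complex.norm_real, Real.norm_eq_abs, sq_abs, mul_inv]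
  have : c ^ 2 ≠ 0 := pow_ne_zero 2 hc
  field_simp

/-- The distribution of `sphereWeights` under a Gaussian measure. -/
theorem lintegral_gaussian_sphereWeights {n s : ℕ}
    (e : Fin (n + s + 1) ≃ Fin (s + 1) ⊕ Fin n) (f : (Fin n → ℝ) → ENNReal) (hf : Measurable f) :
    ∫⁻ g : Fin (n + s + 1) → ℂ,
      ENNReal.ofReal (Real.exp (-∑ i, ‖g i‖ ^ 2)) * f (sphereWeights e g) =
      ENNReal.ofReal Real.pi ^ (n + s + 1) *
        ∫⁻ p in openSimplex n, ENNReal.ofReal (dirichletDensity (n + s + 1) p) * f p := by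
  set F : (Fin (s + 1) → ℂ) × (Fin n → ℂ) → ENNReal := fun q =>
    ENNReal.ofReal (Real.exp (-(∑ i, ‖q.1 i‖ ^ 2 + ∑ k, ‖q.2 k‖ ^ 2))) *
      f ((∑ i, ‖q.1 i‖ ^ 2 + ∑ k, ‖q.2 k‖ ^ 2)⁻¹ • fun k => ‖q.2 k‖ ^ 2) with hF
  have hFm : Measurable F := by
    rw [hF]
    fun_prop
  have h1 := ((volume_measurePreserving_piCongrLeft (fun _ => ℂ) e).trans
    (volume_measurePreserving_sumPiEquivProdPi (fun _ : Fin (s + 1) ⊕ Fin n => ℂ))).lintegral_comp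
    hFm
  have h2 : ∀ g : Fin (n + s + 1) → ℂ,
      ENNReal.ofReal (Real.exp (-∑ i, ‖g i‖ ^ 2)) * f (sphereWeights e g) =
      F (((MeasurableEquiv.piCongrLeft (fun _ => ℂ) e).trans
        (MeasurableEquiv.sumPiEquivProdPi (fun _ : Fin (s + 1) ⊕ Fin n => ℂ))) g) := by
    intro g
    have hg : ∀ j, (MeasurableEquiv.piCongrLeft (fun _ => ℂ) e) g j = g (e.symm j) := by
      intro j
      obtain ⟨i, rfl⟩ := e.surjective j
      rw [MeasurableEquiv.coe_piCongrLeft, Equiv.piCongrLeft_apply_apply, e.symm_apply_apply]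
    have hl : ∀ i, (((MeasurableEquiv.piCongrLeft (fun _ => ℂ) e).trans
        (MeasurableEquiv.sumPiEquivProdPi (fun _ : Fin (s + 1) ⊕ Fin n => ℂ))) g).1 i =
        g (e.symm (Sum.inl i)) := fun i => hg _
    have hr : ∀ i, (((MeasurableEquiv.piCongrLeft (fun _ => ℂ) e).trans
        (MeasurableEquiv.sumPiEquivProdPi (fun _ : Fin (s + 1) ⊕ Fin n => ℂ))) g).2 i =
        g (e.symm (Sum.inr i)) := fun i => hg _
    have hs : ∑ i, ‖g i‖ ^ 2 = ∑ i, ‖g (e.symm (Sum.inl i))‖ ^ 2 +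
        ∑ i, ‖g (e.symm (Sum.inr i))‖ ^ 2 := by
      rw [← e.symm.sum_comp, Fintype.sum_sum_type]
    simp only [hF, hl, hr, ← hs]
    rfl
  simp only [h2]
  refine h1.trans ?_
  rw [Measure.volume_eq_prod, lintegral_prod_symm' _ hFm]
  have h3 : ∀ z : Fin n → ℂ, ∫⁻ w, F (w, z) = ENNReal.ofReal Real.pi ^ (s + 1) *
      ∫⁻ t in Set.Ioi 0, (ENNReal.ofReal (Real.exp (-(t + ∑ k, ‖z k‖ ^ 2))) *
        f ((t + ∑ k, ‖z k‖ ^ 2)⁻¹ • fun k => ‖z k‖ ^ 2)) * ENNReal.ofReal (t ^ s / s !) := fun z =>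
    lintegral_comp_sum_norm_sq s (fun t => ENNReal.ofReal (Real.exp (-(t + ∑ k, ‖z k‖ ^ 2))) *
      f ((t + ∑ k, ‖z k‖ ^ 2)⁻¹ • fun k => ‖z k‖ ^ 2)) (by fun_prop)
  simp only [h3]
  have hm : Measurable fun a : Fin n → ℝ => ∫⁻ t in Set.Ioi 0,
      (ENNReal.ofReal (Real.exp (-(t + ∑ k, a k))) * f ((t + ∑ k, a k)⁻¹ • a)) *
        ENNReal.ofReal (t ^ s / s !) :=
    Measurable.lintegral_prod_right' (f := fun q : (Fin n → ℝ) × ℝ =>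
      (ENNReal.ofReal (Real.exp (-(q.2 + ∑ k, q.1 k))) * f ((q.2 + ∑ k, q.1 k)⁻¹ • q.1)) *
        ENNReal.ofReal (q.2 ^ s / s !)) (by fun_prop)
  rw [lintegral_comp_norm_sq_pi n (fun a => _ * ∫⁻ t in Set.Ioi 0,
      (ENNReal.ofReal (Real.exp (-(t + ∑ k, a k))) * f ((t + ∑ k, a k)⁻¹ • a)) *
        ENNReal.ofReal (t ^ s / s !)) (hm.const_mul _), lintegral_const_mul _ hm,
    lintegral_dirichlet n s f hf, ← mul_assoc, ← pow_add, add_assoc]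

theorem lintegral_gaussian (m : ℕ) :
    ∫⁻ g : Fin (m + 1) → ℂ, ENNReal.ofReal (Real.exp (-∑ i, ‖g i‖ ^ 2)) =
      ENNReal.ofReal Real.pi ^ (m + 1) := by
  rw [lintegral_comp_sum_norm_sq m (fun t => ENNReal.ofReal (Real.exp (-t))) (by fun_prop)]
  have h : ∀ t ∈ Set.Ioi (0 : ℝ), ENNReal.ofReal (Real.exp (-t)) * ENNReal.ofReal (t ^ m / m !) =
      ENNReal.ofReal (m ! : ℝ)⁻¹ * ENNReal.ofReal (Real.exp (-t) * t ^ m) := by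
    intro t ht
    have : 0 < t := ht
    rw [← ENNReal.ofReal_mul (by positivity), ← ENNReal.ofReal_mul (by positivity)]
    congr 1
    ring
  rw [setLIntegral_congr_fun measurableSet_Ioi h, lintegral_const_mul _ (by fun_prop),
    lintegral_exp_neg_mul_pow, ← ENNReal.ofReal_natCast, ← ENNReal.ofReal_mul (by positivity),
    inv_mul_cancel₀ (by positivity)]
  simp

/-! ### Unitary invariance and rows of Haar unitary matrices -/

theorem sum_norm_sq_unitary_mulVec {m : ℕ} {W : Matrix (Fin m) (Fin m) ℂ} (hW : Wᴴ * W = 1)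
    (g : Fin m → ℂ) : ∑ i, ‖(W *ᵥ g) i‖ ^ 2 = ∑ i, ‖g i‖ ^ 2 := by
  have h : ∀ v : Fin m → ℂ, ((∑ i, ‖v i‖ ^ 2 : ℝ) : ℂ) = star v ⬝ᵥ v := by
    intro v
    simp [dotProduct, Complex.conj_mul']
  have h2 : star (W *ᵥ g) ⬝ᵥ (W *ᵥ g) = star g ⬝ᵥ g := by
    rw [Matrix.star_mulVec, ← Matrix.dotProduct_mulVec, Matrix.mulVec_mulVec, hW,
      Matrix.one_mulVec]
  rw [← h, ← h] at h2
  exact_mod_cast h2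

/-- The real determinant of a complex linear map is the squared modulus of its complex determinant,
here `1`. -/
theorem measurePreserving_unitary_mulVec {m : ℕ} {W : Matrix (Fin m) (Fin m) ℂ}
    (hW : Wᴴ * W = 1) : MeasurePreserving (fun g : Fin m → ℂ => W *ᵥ g) volume volume := by
  have hdet : |LinearMap.det ((Matrix.toLin' W).restrictScalars ℝ)| = 1 := by
    rw [LinearMap.det_restrictScalars, LinearMap.det_toLin', Algebra.norm_complex_eq]
    have h : star W.det * W.det = 1 := by
      rw [← Matrix.det_conjTranspose, ← Matrix.det_mul, hW, Matrix.det_one]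
    have h2 : ‖W.det‖ * ‖W.det‖ = 1 := by
      have := congrArg norm h
      simpa using this
    simp [Complex.normSq_eq_norm_sq, sq, h2]
  have hm : Measurable (fun g : Fin m → ℂ => W *ᵥ g) :=
    (Continuous.matrix_mulVec continuous_const continuous_id).measurable
  refine ⟨hm, ?_⟩
  have h := Measure.map_linearMap_addHaar_eq_smul_addHaar (volume : Measure (Fin m → ℂ))
    (f := (Matrix.toLin' W).restrictScalars ℝ) (fun h0 => by rw [h0] at hdet; simp at hdet)
  rw [abs_inv, hdet] at h
  simp only [inv_one, ENNReal.ofReal_one, one_smul] at h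
  exact h

/-- A unit vector extends to an orthonormal basis in which it has index `i`; the basis vectors are
the columns of `V`. This gives transitivity on the unit sphere. -/
theorem exists_unitary_mulVec_single {m : ℕ} (i : Fin m) (v : Fin m → ℂ)
    (hv : ∑ j, ‖v j‖ ^ 2 = 1) :
    ∃ V : Matrix.unitaryGroup (Fin m) ℂ,
      (V : Matrix (Fin m) (Fin m) ℂ) *ᵥ Pi.single i 1 = v := by
  have hon : Orthonormal ℂ (Set.domRestrict ({i} : Set (Fin m))
      (fun _ : Fin m => (WithLp.toLp 2 v : EuclideanSpace ℂ (Fin m)))) := by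
    refine ⟨fun _ => ?_, fun a b hab => absurd (Subsingleton.elim a b) hab⟩
    simp [EuclideanSpace.norm_eq, hv]
  obtain ⟨b, hb⟩ := hon.exists_orthonormalBasis_extension_of_card_eq (by simp)
  refine ⟨⟨(EuclideanSpace.basisFun (Fin m) ℂ).toBasis.toMatrix b,
    (EuclideanSpace.basisFun (Fin m) ℂ).toMatrix_orthonormalBasis_mem_unitary b⟩, ?_⟩
  ext j
  simp [Module.Basis.toMatrix_apply, hb i rfl]

section Haar

variable {m : ℕ} [MeasurableSpace (Matrix.unitaryGroup (Fin m) ℂ)]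
  [BorelSpace (Matrix.unitaryGroup (Fin m) ℂ)]

theorem measurable_unitaryGroup_apply (i j : Fin m) :
    Measurable fun U : Matrix.unitaryGroup (Fin m) ℂ => (U : Matrix (Fin m) (Fin m) ℂ) i j :=
  (Continuous.matrix_elem continuous_subtype_val i j).measurable

theorem measurable_conjTranspose_mulVec :
    Measurable fun q : Matrix.unitaryGroup (Fin m) ℂ × (Fin m → ℂ) =>
      (q.1 : Matrix (Fin m) (Fin m) ℂ)ᴴ *ᵥ q.2 := by
  refine measurable_pi_lambda _ fun i => ?_
  simp only [Matrix.mulVec, dotProduct, Matrix.conjTranspose_apply]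
  refine Finset.measurable_fun_sum _ fun j _ => Measurable.mul ?_ ?_
  · exact continuous_star.measurable.comp ((measurable_unitaryGroup_apply j i).comp measurable_fst)
  · exact (measurable_pi_apply j).comp measurable_snd

/-- The average of a function over an orbit of the unitary group does not depend on the orbit,
if the function is homogeneous of degree `0`. -/
theorem lintegral_conjTranspose_mulVec_eq (μ : Measure (Matrix.unitaryGroup (Fin m) ℂ))
    [μ.IsMulLeftInvariant] (F : (Fin m → ℂ) → ENNReal)
    (hF : ∀ (c : ℝ) (g : Fin m → ℂ), c ≠ 0 → F ((c : ℂ) • g) = F g) (i : Fin m)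
    {g : Fin m → ℂ} (hg : g ≠ 0) :
    ∫⁻ U, F ((U : Matrix (Fin m) (Fin m) ℂ)ᴴ *ᵥ g) ∂μ =
      ∫⁻ U, F ((U : Matrix (Fin m) (Fin m) ℂ)ᴴ *ᵥ Pi.single i 1) ∂μ := by
  have hpos : 0 < ∑ j, ‖g j‖ ^ 2 := by
    obtain ⟨j, hj⟩ := Function.ne_iff.mp hg
    exact Finset.sum_pos' (fun _ _ => by positivity)
      ⟨j, Finset.mem_univ j, pow_pos (norm_pos_iff.mpr hj) 2⟩
  set c : ℝ := √(∑ j, ‖g j‖ ^ 2) with hc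
  have hc0 : c ≠ 0 := (Real.sqrt_pos.mpr hpos).ne'
  have hcsq : c ^ 2 = ∑ j, ‖g j‖ ^ 2 := Real.sq_sqrt hpos.le
  obtain ⟨V, hV⟩ := exists_unitary_mulVec_single i ((c⁻¹ : ℂ) • g) (by
    simp only [Pi.smul_apply, smul_eq_mul, norm_mul, mul_pow, ← Finset.mul_sum, ← hcsq, norm_inv,
      Complex.norm_real, Real.norm_eq_abs, inv_pow, sq_abs]
    exact inv_mul_cancel₀ (pow_ne_zero 2 hc0))
  have hVV : (V : Matrix (Fin m) (Fin m) ℂ) * (V : Matrix (Fin m) (Fin m) ℂ)ᴴ = 1 :=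
    Matrix.mem_unitaryGroup_iff.mp V.2
  -- Replacing `U` by `V * U` moves `g` to a multiple of the basis vector, and homogeneity removes
  -- the scalar.
  rw [← lintegral_mul_left_eq_self _ V]
  refine lintegral_congr fun U => ?_
  have h1 : ((V * U : Matrix.unitaryGroup (Fin m) ℂ) : Matrix (Fin m) (Fin m) ℂ)ᴴ *ᵥ g =
      (c : ℂ) • ((U : Matrix (Fin m) (Fin m) ℂ)ᴴ *ᵥ Pi.single i 1) := by
    have hg' : g = (c : ℂ) • ((V : Matrix (Fin m) (Fin m) ℂ) *ᵥ Pi.single i 1) := by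
      rw [hV, smul_smul, mul_inv_cancel₀ (Complex.ofReal_ne_zero.mpr hc0), one_smul]
    have hVV' := mul_eq_one_comm.mp hVV
    rw [hg', Matrix.mulVec_smul, Matrix.mulVec_mulVec]
    congr 2
    rw [Submonoid.coe_mul, Matrix.conjTranspose_mul, Matrix.mul_assoc, hVV', Matrix.mul_one]
  rw [h1, hF _ _ hc0]

/-- A column of a Haar distributed unitary matrix is a normalised Gaussian vector. -/
theorem lintegral_haar_eq_gaussian
    (μ : Measure (Matrix.unitaryGroup (Fin m) ℂ)) [IsProbabilityMeasure μ]
    [μ.IsMulLeftInvariant] (F : (Fin m → ℂ) → ENNReal) (hFm : Measurable F)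
    (hF : ∀ (c : ℝ) (g : Fin m → ℂ), c ≠ 0 → F ((c : ℂ) • g) = F g) (i : Fin m) :
    (∫⁻ g : Fin m → ℂ, ENNReal.ofReal (Real.exp (-∑ i, ‖g i‖ ^ 2))) *
        ∫⁻ U, F ((U : Matrix (Fin m) (Fin m) ℂ)ᴴ *ᵥ Pi.single i 1) ∂μ =
      ∫⁻ g : Fin m → ℂ, ENNReal.ofReal (Real.exp (-∑ i, ‖g i‖ ^ 2)) * F g := by
  -- Needed for the origin to be a null set; in dimension `0` it would carry all the mass.
  have : Nonempty (Fin m) := ⟨i⟩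
  set E : (Fin m → ℂ) → ENNReal := fun g => ENNReal.ofReal (Real.exp (-∑ i, ‖g i‖ ^ 2))
    with hE
  have hEm : Measurable E := by
    rw [hE]
    fun_prop
  have hEF : Measurable fun g => E g * F g := hEm.mul hFm
  have h1 : ∀ U : Matrix.unitaryGroup (Fin m) ℂ,
      ∫⁻ g, E g * F ((U : Matrix (Fin m) (Fin m) ℂ)ᴴ *ᵥ g) = ∫⁻ g, E g * F g := by
    intro U
    have hU : ((U : Matrix (Fin m) (Fin m) ℂ)ᴴ)ᴴ *
        (U : Matrix (Fin m) (Fin m) ℂ)ᴴ = 1 := by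
      rw [Matrix.conjTranspose_conjTranspose]
      exact Matrix.mem_unitaryGroup_iff.mp U.2
    rw [← (measurePreserving_unitary_mulVec hU).lintegral_comp hEF]
    refine lintegral_congr fun g => ?_
    simp only [hE, sum_norm_sq_unitary_mulVec hU]
  have hFU : Measurable fun q : Matrix.unitaryGroup (Fin m) ℂ × (Fin m → ℂ) =>
      F ((q.1 : Matrix (Fin m) (Fin m) ℂ)ᴴ *ᵥ q.2) :=
    hFm.comp (measurable_conjTranspose_mulVec )
  have h2 : ∀ᵐ g : Fin m → ℂ,
      ∫⁻ U, E g * F ((U : Matrix (Fin m) (Fin m) ℂ)ᴴ *ᵥ g) ∂μ =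
      E g * ∫⁻ U, F ((U : Matrix (Fin m) (Fin m) ℂ)ᴴ *ᵥ Pi.single i 1) ∂μ := by
    filter_upwards [compl_mem_ae_iff.mpr (measure_singleton (0 : Fin m → ℂ))] with g hg
    have hpair : Measurable fun U : Matrix.unitaryGroup (Fin m) ℂ => (U, g) :=
      measurable_id.prodMk measurable_const
    have hm := hFU.comp hpair
    simp only [Function.comp_def] at hm
    rw [lintegral_const_mul _ hm, lintegral_conjTranspose_mulVec_eq μ F hF i hg]
  -- The double integral over `U` and `g` is computed in both orders: for fixed `U` the Gaussian
  -- weight is invariant, for fixed `g ≠ 0` the orbit average is constant.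
  have h3 : ∫⁻ U : Matrix.unitaryGroup (Fin m) ℂ,
      (∫⁻ g, E g * F ((U : Matrix (Fin m) (Fin m) ℂ)ᴴ *ᵥ g)) ∂μ =
      ∫⁻ g, E g * F g := by
    simp [h1]
  rw [← h3, lintegral_lintegral_swap
    ((hEm.comp measurable_snd).mul hFU).aemeasurable,
    lintegral_congr_ae h2, lintegral_mul_const _ hEm]

end Haar

/-- The squared absolute values of some entries in a row of a Haar distributed unitary matrix have
a Dirichlet distribution. -/
theorem lintegral_haar_dirichlet {n s : ℕ}
    [MeasurableSpace (Matrix.unitaryGroup (Fin (n + s + 1)) ℂ)]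
    [BorelSpace (Matrix.unitaryGroup (Fin (n + s + 1)) ℂ)]
    (μ : Measure (Matrix.unitaryGroup (Fin (n + s + 1)) ℂ)) [IsProbabilityMeasure μ]
    [μ.IsMulLeftInvariant] (e : Fin (n + s + 1) ≃ Fin (s + 1) ⊕ Fin n)
    (V : Matrix.unitaryGroup (Fin (n + s + 1)) ℂ) (i : Fin (n + s + 1))
    (f : (Fin n → ℝ) → ENNReal) (hf : Measurable f) :
    ∫⁻ U, f (fun k => ‖(U * V : Matrix.unitaryGroup (Fin (n + s + 1)) ℂ).1 i
        (e.symm (Sum.inr k))‖ ^ 2) ∂μ =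
      ∫⁻ p in openSimplex n, ENNReal.ofReal (dirichletDensity (n + s + 1) p) * f p := by
  have hV : ((V : Matrix (Fin (n + s + 1)) (Fin (n + s + 1)) ℂ)ᴴ)ᴴ *
      (V : Matrix (Fin (n + s + 1)) (Fin (n + s + 1)) ℂ)ᴴ = 1 := by
    rw [Matrix.conjTranspose_conjTranspose]
    exact Matrix.mem_unitaryGroup_iff.mp V.2
  set F : (Fin (n + s + 1) → ℂ) → ENNReal := fun g =>
    f (sphereWeights e ((V : Matrix (Fin (n + s + 1)) (Fin (n + s + 1)) ℂ)ᴴ *ᵥ g)) with hFdef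
  have hmp := measurePreserving_unitary_mulVec hV
  have hFm : Measurable F := hf.comp ((measurable_sphereWeights e).comp hmp.measurable)
  have hF : ∀ (c : ℝ) (g : Fin (n + s + 1) → ℂ), c ≠ 0 → F ((c : ℂ) • g) = F g := by
    intro c g hc
    simp only [hFdef, Matrix.mulVec_smul, sphereWeights_smul e hc]
  have h1 := lintegral_haar_eq_gaussian μ F hFm hF i
  -- The fixed right factor `V` is absorbed by the unitary invariance of the Gaussian weight, so
  -- only left invariance of `μ` is used.
  have h2 : ∫⁻ g : Fin (n + s + 1) → ℂ, ENNReal.ofReal (Real.exp (-∑ i, ‖g i‖ ^ 2)) * F g =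
      ∫⁻ g : Fin (n + s + 1) → ℂ,
        ENNReal.ofReal (Real.exp (-∑ i, ‖g i‖ ^ 2)) * f (sphereWeights e g) := by
    have hm : Measurable fun g : Fin (n + s + 1) → ℂ =>
        ENNReal.ofReal (Real.exp (-∑ i, ‖g i‖ ^ 2)) * f (sphereWeights e g) :=
      Measurable.mul (by fun_prop) (hf.comp (measurable_sphereWeights e))
    rw [← hmp.lintegral_comp hm]
    refine lintegral_congr fun g => ?_
    simp only [sum_norm_sq_unitary_mulVec hV, hFdef]
  rw [h2, lintegral_gaussian, lintegral_gaussian_sphereWeights e f hf] at h1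
  have hpi : ENNReal.ofReal Real.pi ^ (n + s + 1) ≠ 0 :=
    pow_ne_zero _ (ENNReal.ofReal_pos.mpr Real.pi_pos).ne'
  rw [← (ENNReal.mul_right_inj hpi (ENNReal.pow_ne_top ENNReal.ofReal_ne_top)).mp h1]
  refine lintegral_congr fun U => ?_
  simp only [hFdef]
  congr 1
  ext k
  -- The vector `Vᴴ Uᴴ e_i = (U V)ᴴ e_i` has as coordinates the conjugates of row `i` of `U V`, and
  -- it has norm one, so the normalisation disappears.
  have hU : ((U : Matrix (Fin (n + s + 1)) (Fin (n + s + 1)) ℂ)ᴴ)ᴴ *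
      (U : Matrix (Fin (n + s + 1)) (Fin (n + s + 1)) ℂ)ᴴ = 1 := by
    rw [Matrix.conjTranspose_conjTranspose]
    exact Matrix.mem_unitaryGroup_iff.mp U.2
  have hone : ∑ j, ‖(Pi.single i 1 : Fin (n + s + 1) → ℂ) j‖ ^ 2 = 1 := by
    rw [Finset.sum_eq_single i (fun j _ hj => by simp [hj]) (by simp)]
    simp
  rw [sphereWeights, sum_norm_sq_unitary_mulVec hV, sum_norm_sq_unitary_mulVec hU, hone, inv_one,
    one_mul, Matrix.mulVec_mulVec, ← Matrix.conjTranspose_mul, Matrix.mulVec_single_one,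
    Matrix.col_apply, Matrix.conjTranspose_apply, norm_star]
  rfl

/-! ### Eigenvalues of the corner in terms of the weights -/

theorem exists_equiv_of_map_univ_eq {ι κ β : Type*} [Fintype ι] [Fintype κ] (f : ι → β)
    (g : κ → β) (h : Finset.univ.val.map f = Finset.univ.val.map g) :
    ∃ e : ι ≃ κ, ∀ i, f i = g (e i) := by
  classical
  have hE : ∀ b, Nonempty ({i // f i = b} ≃ {k // g k = b}) := fun b => by
    have h1 := congrArg (Multiset.count b) h
    rw [Multiset.count_map, Multiset.count_map] at h1
    refine Fintype.card_eq.mp ?_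
    rw [Fintype.card_subtype, Fintype.card_subtype]
    simpa only [Finset.card_def, Finset.filter_val, eq_comm (a := b)] using h1
  exact ⟨(Equiv.sigmaFiberEquiv f).symm.trans ((Equiv.sigmaCongrRight fun b => (hE b).some).trans
    (Equiv.sigmaFiberEquiv g)), fun i => ((hE (f i)).some ⟨i, rfl⟩).2.symm⟩

theorem exists_equiv_of_hermEigenvalues {n s : ℕ}
    {A : Matrix (Fin (n + s + 1)) (Fin (n + s + 1)) ℂ} (hA : A.IsHermitian) (x : Fin n → ℝ)
    (hx : hermEigenvalues hA = Multiset.replicate (s + 1) 0 + Finset.univ.val.map x) :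
    ∃ e : Fin (n + s + 1) ≃ Fin (s + 1) ⊕ Fin n,
      ∀ i, hA.eigenvalues i = Sum.elim (fun _ => 0) x (e i) := by
  have h1 : (Finset.univ : Finset (Fin (s + 1) ⊕ Fin n)).val.map (Sum.elim (fun _ => (0 : ℝ)) x) =
      Multiset.replicate (s + 1) 0 + Finset.univ.val.map x := by
    rw [← Finset.univ_disjSum_univ, Finset.val_disjSum, Multiset.disjSum, Multiset.map_add,
      Multiset.map_map, Multiset.map_map]
    congr 1
    rw [Sum.elim_comp_inl, Multiset.map_const']
    simp
  exact exists_equiv_of_map_univ_eq _ _ (hx.trans h1.symm)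

open Polynomial in
theorem hermEigenvalues_eq_of_charpoly {d : ℕ} {A : Matrix (Fin d) (Fin d) ℂ}
    (hA : A.IsHermitian) (M : Multiset ℝ)
    (h : A.charpoly = (M.map fun t : ℝ => X - C (t : ℂ)).prod) : hermEigenvalues hA = M := by
  have h1 := hA.roots_charpoly_eq_eigenvalues
  have h2 : M.map (fun t : ℝ => X - C (t : ℂ)) =
      (M.map ((↑) : ℝ → ℂ)).map fun a => X - C a := by
    rw [Multiset.map_map]; rfl
  rw [h, h2, roots_multiset_prod_X_sub_C, ← Multiset.map_map] at h1
  exact (Multiset.map_injective Complex.ofReal_injective h1).symm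

/-- The squared absolute values of the coordinates of the last row of `U` with respect to the
eigenvectors which belong to the nonzero eigenvalues. -/
noncomputable def cornerWeights {n s : ℕ} (e : Fin (n + s + 1) ≃ Fin (s + 1) ⊕ Fin n)
    (V U : Matrix.unitaryGroup (Fin (n + s + 1)) ℂ) (k : Fin n) : ℝ :=
  ‖(U * V : Matrix.unitaryGroup (Fin (n + s + 1)) ℂ).1 (Fin.last (n + s))
    (e.symm (Sum.inr k))‖ ^ 2

theorem measurable_cornerWeights {n s : ℕ}
    [MeasurableSpace (Matrix.unitaryGroup (Fin (n + s + 1)) ℂ)]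
    [BorelSpace (Matrix.unitaryGroup (Fin (n + s + 1)) ℂ)]
    (e : Fin (n + s + 1) ≃ Fin (s + 1) ⊕ Fin n)
    (V : Matrix.unitaryGroup (Fin (n + s + 1)) ℂ) : Measurable (cornerWeights e V) := by
  refine measurable_pi_lambda _ fun k => ?_
  have h := (measurable_unitaryGroup_apply (Fin.last (n + s)) (e.symm (Sum.inr k))).comp
    (measurable_mul_const V)
  exact (h.norm).pow_const 2

-- In an eigenbasis of `A` the cofactor formula has the coefficients `|Q_{last,i}|²`, which sum to
-- `1` because the rows of `Q` are unit vectors. Grouping the indices by `e` gives `weightPoly`.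
open Polynomial in
theorem charpoly_conjCorner {n s : ℕ}
    {A : Matrix (Fin (n + s + 1)) (Fin (n + s + 1)) ℂ} (hA : A.IsHermitian) (x : Fin n → ℝ)
    (e : Fin (n + s + 1) ≃ Fin (s + 1) ⊕ Fin n)
    (he : ∀ i, hA.eigenvalues i = Sum.elim (fun _ => 0) x (e i))
    (U : Matrix.unitaryGroup (Fin (n + s + 1)) ℂ) :
    (conjCorner A U).charpoly =
      (X ^ s * weightPoly x (cornerWeights e hA.eigenvectorUnitary U)).map Complex.ofRealHom := by
  set W : Matrix.unitaryGroup (Fin (n + s + 1)) ℂ := U * hA.eigenvectorUnitary with hW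
  set Q : Matrix (Fin (n + s + 1)) (Fin (n + s + 1)) ℂ := W.1 with hQ
  have hQQ : Q * Qᴴ = 1 := Matrix.mem_unitaryGroup_iff.mp W.2
  have h1 : (U : Matrix (Fin (n + s + 1)) (Fin (n + s + 1)) ℂ) * A *
      (U : Matrix (Fin (n + s + 1)) (Fin (n + s + 1)) ℂ)ᴴ =
      Q * Matrix.diagonal (fun i => (hA.eigenvalues i : ℂ)) * Qᴴ := by
    conv_lhs => rw [hA.spectral_theorem, Unitary.conjStarAlgAut_apply]
    rw [hQ, hW, Submonoid.coe_mul, Matrix.conjTranspose_mul]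
    simp only [Matrix.mul_assoc, Matrix.star_eq_conjTranspose]
    rfl
  have h2 : (conjCorner A U).charpoly = ((Q * Matrix.diagonal (fun i => (hA.eigenvalues i : ℂ)) *
      Qᴴ).submatrix Fin.castSucc Fin.castSucc).charpoly := by
    rw [← h1]
    rfl
  rw [h2, charpoly_submatrix_castSucc, adjugate_charmatrix_conj_diagonal hQQ]
  set q : Fin (s + 1) → ℝ := fun i => ‖Q (Fin.last (n + s)) (e.symm (Sum.inl i))‖ ^ 2 with hq
  have hqp : ∀ j, Sum.elim q (cornerWeights e hA.eigenvectorUnitary U) j =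
      ‖Q (Fin.last (n + s)) (e.symm j)‖ ^ 2 := by
    rintro (j | j) <;> rfl
  have hsum : ∑ i, q i + ∑ k, cornerWeights e hA.eigenvectorUnitary U k = 1 := by
    have h3 : ∑ i, ‖Q (Fin.last (n + s)) i‖ ^ 2 = 1 := by
      have h4 := congrFun (congrFun hQQ (Fin.last (n + s))) (Fin.last (n + s))
      rw [Matrix.mul_apply, Matrix.one_apply_eq] at h4
      have h5 : ((∑ i, ‖Q (Fin.last (n + s)) i‖ ^ 2 : ℝ) : ℂ) = 1 := by
        rw [← h4]
        simp [Matrix.conjTranspose_apply, Complex.mul_conj']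
      exact_mod_cast h5
    rw [← h3, ← e.symm.sum_comp, Fintype.sum_sum_type]
    rfl
  rw [← sum_prod_erase_sumElim x _ q hsum, Polynomial.map_sum, ← e.sum_comp]
  refine Finset.sum_congr rfl fun i _ => ?_
  rw [Polynomial.map_mul, Polynomial.map_C, Polynomial.map_prod, hqp, e.symm_apply_apply]
  congr 1
  · rw [Matrix.conjTranspose_apply]
    simp [Complex.mul_conj']
  · refine Finset.prod_equiv e (by simp) fun j _ => ?_
    rw [he]
    simp

open Polynomial in
theorem hermEigenvalues_conjCorner {n s : ℕ}
    {A : Matrix (Fin (n + s + 1)) (Fin (n + s + 1)) ℂ} (hA : A.IsHermitian) {x : Fin n → ℝ}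
    (hx_pos : ∀ k, 0 < x k) (hx_inj : Function.Injective x)
    {e : Fin (n + s + 1) ≃ Fin (s + 1) ⊕ Fin n}
    (he : ∀ i, hA.eigenvalues i = Sum.elim (fun _ => 0) x (e i))
    (U : Matrix.unitaryGroup (Fin (n + s + 1)) ℂ) {y : Fin n → ℝ}
    (hy : rootWeights x y = cornerWeights e hA.eigenvectorUnitary U) :
    hermEigenvalues (conjCorner_isHermitian hA U) =
      Multiset.replicate s 0 + Finset.univ.val.map y := by
  refine hermEigenvalues_eq_of_charpoly _ _ ?_
  rw [charpoly_conjCorner hA x e he U, (weightPoly_eq_prod_iff hx_pos hx_inj _ y).mpr hy]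
  rw [Multiset.map_add, Multiset.prod_add, Multiset.map_map, Multiset.map_replicate,
    Multiset.prod_replicate, Polynomial.map_mul, Polynomial.map_prod]
  simp [-Fin.univ_val_map]

/-- A continuous injection on a Borel subset of `ℝ ^ n` is a measurable embedding (Lusin–Souslin),
so its inverse extends measurably to the whole space. This makes the eigenvalues measurable
functions of the weights. -/
theorem exists_measurable_rootWeights_inverse {n : ℕ} {x : Fin n → ℝ} (hx_pos : ∀ k, 0 < x k)
    (hx : StrictMono x) :
    ∃ Ψ : (Fin n → ℝ) → Fin n → ℝ, Measurable Ψ ∧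
      ∀ y ∈ interlacingSet x, Ψ (rootWeights x y) = y := by
  have hemb := (continuous_rootWeights x).continuousOn.measurableEmbedding
    (measurableSet_interlacingSet x) (rootWeights_injOn hx_pos hx)
  obtain ⟨Ψ, hΨ, h⟩ := hemb.exists_measurable_extend measurable_subtype_coe
    (fun _ => ⟨0⟩)
  exact ⟨Ψ, hΨ, fun y hy => congrFun h ⟨y, hy⟩⟩

/-! ### The law of the corner eigenvalues -/

theorem proposition4p1 {m n : ℕ} (hmn : n + 1 ≤ m)
    (X : Matrix (Fin m) (Fin m) ℂ) (hX : X.PosSemidef)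
    (x : Fin n → ℝ) (hx_pos : ∀ k, 0 < x k) (hx_mono : StrictMono x)
    (hx : hermEigenvalues hX.isHermitian =
      Multiset.replicate (m - n) 0 + Finset.univ.val.map x)
    [MeasurableSpace (Matrix.unitaryGroup (Fin m) ℂ)] [BorelSpace (Matrix.unitaryGroup (Fin m) ℂ)]
    {Ω : Type*} [MeasurableSpace Ω] (P : Measure Ω) [IsProbabilityMeasure P]
    (U : Ω → Matrix.unitaryGroup (Fin m) ℂ) (hU : AEMeasurable U P)
    (hU_haar : (P.map U).IsHaarMeasure) :
    ∃ y : Ω → Fin n → ℝ, AEMeasurable y P ∧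
      (∀ᵐ ω ∂P,
        hermEigenvalues (conjCorner_isHermitian hX.isHermitian (U ω)) =
          Multiset.replicate (m - 1 - n) 0 + Finset.univ.val.map (y ω) ∧
        StrictMono (y ω) ∧ y ω ∈ interlacingSet x) ∧
      P.map y = (volume.restrict (interlacingSet x)).withDensity
        (fun t => ENNReal.ofReal (cornerDensity m x t)) := by
  obtain ⟨s, rfl⟩ : ∃ s, m = n + s + 1 := ⟨m - n - 1, by omega⟩
  have hs1 : n + s + 1 - n = s + 1 := by omega
  have hs2 : n + s + 1 - 1 - n = s := by omega
  rw [hs1] at hx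
  simp only [hs2]
  obtain ⟨e, he⟩ := exists_equiv_of_hermEigenvalues hX.isHermitian x hx
  obtain ⟨Ψ, hΨm, hΨ⟩ := exists_measurable_rootWeights_inverse hx_pos hx_mono
  set V := hX.isHermitian.eigenvectorUnitary with hV
  have : IsProbabilityMeasure (P.map U) := Measure.isProbabilityMeasure_map hU
  have hwm : Measurable (cornerWeights e V) := measurable_cornerWeights e V
  have hlaw : ∀ f : (Fin n → ℝ) → ENNReal, Measurable f →
      ∫⁻ ω, f (cornerWeights e V (U ω)) ∂P =
      ∫⁻ p in openSimplex n, ENNReal.ofReal (dirichletDensity (n + s + 1) p) * f p := by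
    intro f hf
    rw [← lintegral_haar_dirichlet (P.map U) e V (Fin.last (n + s)) f hf]
    exact (lintegral_map' (hf.comp hwm).aemeasurable hU).symm
  -- The law of the weights is carried by the open simplex, so the complement has probability zero;
  -- the values of `Ψ` outside the simplex do not matter.
  have hmem : ∀ᵐ ω ∂P, cornerWeights e V (U ω) ∈ openSimplex n := by
    have hS := (measurableSet_openSimplex n).compl
    have h := hlaw ((openSimplex n)ᶜ.indicator 1) (measurable_one.indicator hS)
    have h0 : ∫⁻ p in openSimplex n, ENNReal.ofReal (dirichletDensity (n + s + 1) p) *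
        (openSimplex n)ᶜ.indicator 1 p = 0 := by
      rw [setLIntegral_congr_fun (g := 0) (measurableSet_openSimplex n) fun p hp => by simp [hp]]
      simp
    have hind : AEMeasurable
        (fun ω => (openSimplex n)ᶜ.indicator (1 : (Fin n → ℝ) → ENNReal) (cornerWeights e V (U ω))) P :=
      (measurable_one.indicator hS).comp_aemeasurable (hwm.comp_aemeasurable hU)
    rw [h0, lintegral_eq_zero_iff' hind] at h
    filter_upwards [h] with ω hω
    by_contra hc
    simp [hc] at hω
  have hym : AEMeasurable (fun ω => Ψ (cornerWeights e V (U ω))) P :=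
    hΨm.comp_aemeasurable (hwm.comp_aemeasurable hU)
  refine ⟨fun ω => Ψ (cornerWeights e V (U ω)), hym, ?_, ?_⟩
  · filter_upwards [hmem] with ω hω
    obtain ⟨y, hy, hyw⟩ := rootWeights_surjOn hx_pos hx_mono hω
    have hyΨ : Ψ (cornerWeights e V (U ω)) = y := by rw [← hyw, hΨ y hy]
    rw [hyΨ]
    exact ⟨hermEigenvalues_conjCorner hX.isHermitian hx_pos hx_mono.injective he (U ω) hyw,
      interlacingSet.strictMono hx_mono hy, hy⟩
  -- Test functions `f` of `y` are test functions `f ∘ Ψ` of the weights; the change of variables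
  -- carries the Dirichlet density to `cornerDensity`, and `Ψ` cancels `rootWeights x` on the
  -- interlacing set.
  · refine Measure.ext_of_lintegral _ fun f hf => ?_
    have hdm : Measurable fun t : Fin n → ℝ => ENNReal.ofReal (cornerDensity (n + s + 1) x t) := by
      unfold cornerDensity vandermondeProd
      fun_prop
    rw [lintegral_map' hf.aemeasurable hym,
      lintegral_withDensity_eq_lintegral_mul _ hdm hf, hlaw (fun p => f (Ψ p)) (hf.comp hΨm),
      lintegral_interlacingSet_cornerDensity hmn hx_pos hx_mono]
    refine setLIntegral_congr_fun (measurableSet_interlacingSet x) fun y hy => ?_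
    simp only [hΨ y hy, Pi.mul_apply]
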